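/- Let $\Bbbk$ be a field of characteristic zero, $I$ a finite set, $A=(a_{ij})_{i,j\in I}$ a generalized symmetrizable Cartan matrix, and $d_i$ ($i\in I$) positive integers with $d_ia_{ij}=d_ja_{ji}$ for all $i,j$. Let $P=(p_{ij})$ be an $I\times I$ matrix over $\Bbbk[[\hbar]]$ of Cartan type, i.e. $p_{ij}+p_{ji}=2d_ia_{ij}$ for all $i,j\in I$. Let $\mathcal R=(\mathfrak h,\Pi,\Pi^\vee)$ be a realization of $P$: $\mathfrak h$ is a free $\Bbbk[[\hbar]]$-module of finite rank, $\Pi^\vee=\{T_i^+,T_i^-\}_{i\in I}\subseteq\mathfrak h$ and $\Pi=\{\alpha_i\}_{i\in I}\subseteq\mathfrak h^*=\mathrm{Hom}_{\Bbbk[[\hbar]]}(\mathfrak h,\Bbbk[[\hbar]])$ satisfy $\alpha_j(T_i^+)=p_{ij}$, $\alpha_j(T_i^-)=p_{ji}$, and the classes of $S_i=\tfrac12(T_i^++T_i^-)$, $i\in I$, are $\Bbbk$-linearly independent in $\mathfrak h/\hbar\mathfrak h$. In a $\hbar$-adically complete $\Bbbk[[\hbar]]$-algebra write $e^{\hbar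 X}=\sum_{n\ge0}\hbar^nX^n/n!$, and put $q_i=e^{\hbar d_i}$, $q_{ij}^{1/2}=e^{\hbar p_{ij}/2}\in\Bbbk[[\hbar]]$. Let ${n\brack k}_q=\frac{[n]_q!}{[k]_q!\,[n-k]_q!}$ with $[n]_q!=[1]_q\cdots[n]_q$ and $[s]_q=q^{s-1}+q^{s-3}+\cdots+q^{1-s}$. The formal multiparameter quantized universal enveloping algebra (FoMpQUEA) $U=U^{\mathcal R}_{P,\hbar}(\mathfrak g)$ is the unital associative topological $\hbar$-adically complete $\Bbbk[[\hbar]]$-algebra generated by the $\Bbbk[[\hbar]]$-module $\mathfrak h$ and elements $E_i,F_i$ ($i\in I$), with relations, for $T,T',T''\in\mathfrak h$ and $i,j\in I$, $$TE_j-E_jT=\alpha_j(T)E_j,\qquad TF_j-F_jT=-\alpha_j(T)F_j,\qquad T'T''=T''T',$$ $$E_iF_j-F_jE_i=\delta_{ij}\,\frac{e^{\hbar T_i^+}-e^{-\hbar T_i^-}}{q_i-q_i^{-1}}$$ (a common factor $\hbar$ being cancelled in the fraction), and, for $i\neq j$, $$\sum_{k=0}^{1-a_{ij}}(-1)^k{1-a_{ij}\brack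 k}_{q_i}q_{ij}^{k/2}q_{ji}^{-k/2}\,E_i^{1-a_{ij}-k}E_jE_i^{k}=0,$$ $$\sum_{k=0}^{1-a_{ij}}(-1)^k{1-a_{ij}\brack k}_{q_i}q_{ij}^{k/2}q_{ji}^{-k/2}\,F_i^{k}F_jF_i^{1-a_{ij}-k}=0.$$ Theorem. $U$ carries a structure of topological Hopf algebra over $\Bbbk[[\hbar]]$, with coproduct $\Delta:U\to U\,\widehat\otimes_{\Bbbk[[\hbar]]}U$ valued in the $\hbar$-adically completed tensor product, such that for all $T\in\mathfrak h$ and $\ell\in I$ $$\Delta(E_\ell)=E_\ell\otimes1+e^{\hbar T_\ell^+}\otimes E_\ell,\qquad \Delta(T)=T\otimes1+1\otimes T,\qquad \Delta(F_\ell)=F_\ell\otimes e^{-\hbar T_\ell^-}+1\otimes F_\ell,$$ $$\epsilon(E_\ell)=0,\qquad\epsilon(T)=0,\qquad\epsilon(F_\ell)=0,$$ $$\mathcal S(E_\ell)=-e^{-\hbar T_\ell^+}E_\ell,\qquad \mathcal S(T)=-T,\qquad \mathcal S(F_\ell)=-F_\ell\,e^{\hbar T_\ell^-}.$$ -/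

import Mathlib

open scoped TensorProduct PowerSeries

noncomputable section

namespace FoMpQUEA

/-- The ideal `(ħ)` of `𝕜[[ħ]]`; the formal variable `ħ` is `PowerSeries.X`. -/
abbrev hIdeal (k : Type*) [Field k] : Ideal k⟦X⟧ := Ideal.span {PowerSeries.X}

/-! ### The `ħ`-adic completion of a (noncommutative) algebra -/

section Completion

/-- The `ħ`-adic completion `lim A / ħⁿA` of a `𝕜[[ħ]]`-algebra. -/
def Completion (k : Type*) [Field k] (A : Type*) [Ring A] [Algebra k⟦X⟧ A] : Type _ :=
  AdicCompletion (hIdeal k) A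

namespace Completion

variable {k : Type*} [Field k]

variable {A : Type*} [Ring A] [Algebra k⟦X⟧ A]
  {N : Type*} [AddCommGroup N] [Module k⟦X⟧ N] [IsAdicComplete (hIdeal k) N]

instance : AddCommGroup (Completion k A) := inferInstanceAs (AddCommGroup (AdicCompletion _ A))

instance : Module k⟦X⟧ (Completion k A) := inferInstanceAs (Module k⟦X⟧ (AdicCompletion _ A))

instance : IsAdicComplete (hIdeal k) (Completion k A) :=
  AdicCompletion.isAdicComplete (I := hIdeal k) (M := A) ⟨{PowerSeries.X}, by simp⟩

/-- The canonical map `A → lim A / ħⁿA`. -/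
def of : A →ₗ[k⟦X⟧] Completion k A := AdicCompletion.of (hIdeal k) A

/-- The projection `lim A / ħⁿA → A / ħⁿA`. -/
def proj (n : ℕ) : Completion k A →ₗ[k⟦X⟧] A ⧸ (hIdeal k ^ n • ⊤ : Submodule k⟦X⟧ A) :=
  AdicCompletion.eval (hIdeal k) A n

theorem proj_of (n : ℕ) (x : A) : proj n (of x : Completion k A) = Submodule.Quotient.mk x := rfl

theorem ext {x y : Completion k A} (h : ∀ n, proj n x = proj n y) : x = y :=
  AdicCompletion.ext h

theorem exists_rep (x : Completion k A) (n : ℕ) : ∃ a : A, Submodule.Quotient.mk a = proj n x :=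
  Submodule.Quotient.mk_surjective _ _

theorem factorPow_proj {m n : ℕ} (hmn : m ≤ n) (x : Completion k A) :
    Submodule.factorPow (hIdeal k) A hmn (proj n x) = proj m x :=
  x.property hmn

/-- The unique (automatically continuous) linear extension to the completion of a
linear map with `ħ`-adically complete target. -/
def extend (f : A →ₗ[k⟦X⟧] N) : Completion k A →ₗ[k⟦X⟧] N :=
  (AdicCompletion.ofLinearEquiv (hIdeal k) N).symm.toLinearMap ∘ₗ
    (AdicCompletion.map (hIdeal k) f).restrictScalars k⟦X⟧

theorem extend_of (f : A →ₗ[k⟦X⟧] N) (x : A) :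
    extend f (of x) = f x := by
  change (AdicCompletion.ofLinearEquiv (hIdeal k) N).symm
    (AdicCompletion.map (hIdeal k) f (AdicCompletion.of (hIdeal k) A x)) = f x
  rw [AdicCompletion.map_of, AdicCompletion.ofLinearEquiv_symm_of]

/-- The map induced on completions by a linear map. -/
def map {B : Type*} [Ring B] [Algebra k⟦X⟧ B] (f : A →ₗ[k⟦X⟧] B) :
    Completion k A →ₗ[k⟦X⟧] Completion k B :=
  extend (of ∘ₗ f)

theorem mul_mem_left {I : Ideal k⟦X⟧} (a : A) {b : A} (hb : b ∈ (I • ⊤ : Submodule k⟦X⟧ A)) :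
    a * b ∈ (I • ⊤ : Submodule k⟦X⟧ A) := by
  have h := Submodule.mem_map_of_mem (f := LinearMap.mulLeft k⟦X⟧ a) hb
  rw [Submodule.map_smul''] at h
  exact Submodule.smul_mono le_rfl le_top h

theorem mul_mem_right {I : Ideal k⟦X⟧} {a : A} (b : A) (ha : a ∈ (I • ⊤ : Submodule k⟦X⟧ A)) :
    a * b ∈ (I • ⊤ : Submodule k⟦X⟧ A) := by
  have h := Submodule.mem_map_of_mem (f := LinearMap.mulRight k⟦X⟧ b) ha
  rw [Submodule.map_smul''] at h
  exact Submodule.smul_mono le_rfl le_top h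

/-- Multiplication on `A / ħⁿA`. -/
def mulQuot (n : ℕ) (x y : A ⧸ (hIdeal k ^ n • ⊤ : Submodule k⟦X⟧ A)) :
    A ⧸ (hIdeal k ^ n • ⊤ : Submodule k⟦X⟧ A) :=
  Quotient.map₂ (· * ·) (by
    intro a a' ha b b' hb
    have ha' : a - a' ∈ _ := (Submodule.quotientRel_def _).1 ha
    have hb' : b - b' ∈ _ := (Submodule.quotientRel_def _).1 hb
    refine (Submodule.quotientRel_def _).2 ?_
    have : a * b - a' * b' = (a - a') * b + a' * (b - b') := by noncomm_ring
    change a * b - a' * b' ∈ _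
    rw [this]
    exact Submodule.add_mem _ (mul_mem_right b ha') (mul_mem_left a' hb')) x y

theorem mulQuot_mk (n : ℕ) (a b : A) :
    mulQuot (k := k) n (Submodule.Quotient.mk a) (Submodule.Quotient.mk b) =
      Submodule.Quotient.mk (a * b) := rfl

instance : Mul (Completion k A) where
  mul x y := ⟨fun n => mulQuot n (proj n x) (proj n y), by
    intro m n hmn
    obtain ⟨a, ha⟩ := exists_rep x n
    obtain ⟨b, hb⟩ := exists_rep y n
    change Submodule.factorPow (hIdeal k) A hmn (mulQuot n (proj n x) (proj n y)) =
      mulQuot m (proj m x) (proj m y)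
    rw [← factorPow_proj hmn x, ← factorPow_proj hmn y, ← ha, ← hb]
    rfl⟩

instance : One (Completion k A) where
  one := of 1

theorem proj_mul (n : ℕ) (x y : Completion k A) :
    proj n (x * y) = mulQuot n (proj n x) (proj n y) := rfl

theorem proj_one (n : ℕ) : proj n (1 : Completion k A) = Submodule.Quotient.mk 1 := rfl

/-- The ring structure on the `ħ`-adic completion of a `𝕜[[ħ]]`-algebra. -/
instance : Ring (Completion k A) where
  __ := (inferInstance : AddCommGroup (Completion k A))
  left_distrib x y z := ext fun n => by
    obtain ⟨a, ha⟩ := exists_rep x n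
    obtain ⟨b, hb⟩ := exists_rep y n
    obtain ⟨c, hc⟩ := exists_rep z n
    simp only [proj_mul, map_add, ← ha, ← hb, ← hc, ← Submodule.Quotient.mk_add, mulQuot_mk,
      mul_add]
  right_distrib x y z := ext fun n => by
    obtain ⟨a, ha⟩ := exists_rep x n
    obtain ⟨b, hb⟩ := exists_rep y n
    obtain ⟨c, hc⟩ := exists_rep z n
    simp only [proj_mul, map_add, ← ha, ← hb, ← hc, ← Submodule.Quotient.mk_add, mulQuot_mk,
      add_mul]
  zero_mul x := ext fun n => by
    obtain ⟨a, ha⟩ := exists_rep x n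
    simp only [proj_mul, map_zero, ← ha, ← Submodule.Quotient.mk_zero, mulQuot_mk, zero_mul]
  mul_zero x := ext fun n => by
    obtain ⟨a, ha⟩ := exists_rep x n
    simp only [proj_mul, map_zero, ← ha, ← Submodule.Quotient.mk_zero, mulQuot_mk, mul_zero]
  mul_assoc x y z := ext fun n => by
    obtain ⟨a, ha⟩ := exists_rep x n
    obtain ⟨b, hb⟩ := exists_rep y n
    obtain ⟨c, hc⟩ := exists_rep z n
    simp only [proj_mul, ← ha, ← hb, ← hc, mulQuot_mk, mul_assoc]
  one_mul x := ext fun n => by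
    obtain ⟨a, ha⟩ := exists_rep x n
    simp only [proj_mul, proj_one, ← ha, mulQuot_mk, one_mul]
  mul_one x := ext fun n => by
    obtain ⟨a, ha⟩ := exists_rep x n
    simp only [proj_mul, proj_one, ← ha, mulQuot_mk, mul_one]

instance : Algebra k⟦X⟧ (Completion k A) :=
  Algebra.ofModule
    (fun r x y => ext fun n => by
      obtain ⟨a, ha⟩ := exists_rep x n
      obtain ⟨b, hb⟩ := exists_rep y n
      simp only [proj_mul, map_smul, ← ha, ← hb, ← Submodule.Quotient.mk_smul, mulQuot_mk,
        smul_mul_assoc])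
    (fun r x y => ext fun n => by
      obtain ⟨a, ha⟩ := exists_rep x n
      obtain ⟨b, hb⟩ := exists_rep y n
      simp only [proj_mul, map_smul, ← ha, ← hb, ← Submodule.Quotient.mk_smul, mulQuot_mk,
        mul_smul_comm])

/-- The canonical map `A → lim A / ħⁿA` as a homomorphism of algebras. -/
def ofAlgHom : A →ₐ[k⟦X⟧] Completion k A :=
  AlgHom.ofLinearMap of rfl fun _ _ => rfl

end Completion

end Completion

/-! ### Exponentials -/

section Exponential

variable {k : Type*} [Field k]

section Module

variable {M : Type*} [AddCommGroup M] [Module k⟦X⟧ M] [IsAdicComplete (hIdeal k) M]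

/-- The sum `∑ₙ ħⁿ xₙ` of an arbitrary sequence of elements of an `ħ`-adically complete module. -/
def hSum (x : ℕ → M) : M :=
  (AdicCompletion.ofLinearEquiv (hIdeal k) M).symm
    (AdicCompletion.mk (hIdeal k) M
      (AdicCompletion.AdicCauchySequence.mk (hIdeal k) M
        (fun n => ∑ m ∈ Finset.range n, (PowerSeries.X : k⟦X⟧) ^ m • x m)
        (fun n => by
          refine SModEq.symm (SModEq.sub_mem.2 ?_)
          rw [Finset.sum_range_succ, add_sub_cancel_left]
          exact Submodule.smul_mem_smul
            (Ideal.pow_mem_pow (Ideal.mem_span_singleton_self _) n) trivial)))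

theorem hSum_smodEq (x : ℕ → M) (n : ℕ) :
    ∑ m ∈ Finset.range n, (PowerSeries.X : k⟦X⟧) ^ m • x m ≡ hSum (k := k) x
      [SMOD (hIdeal k ^ n • ⊤ : Submodule k⟦X⟧ M)] := by
  have h := congrArg (AdicCompletion.eval (hIdeal k) M n)
    (AdicCompletion.of_ofLinearEquiv_symm (hIdeal k)
      (AdicCompletion.mk (hIdeal k) M
      (AdicCompletion.AdicCauchySequence.mk (hIdeal k) M
        (fun n => ∑ m ∈ Finset.range n, (PowerSeries.X : k⟦X⟧) ^ m • x m)
        (fun n => by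
          refine SModEq.symm (SModEq.sub_mem.2 ?_)
          rw [Finset.sum_range_succ, add_sub_cancel_left]
          exact Submodule.smul_mem_smul
            (Ideal.pow_mem_pow (Ideal.mem_span_singleton_self _) n) trivial))))
  exact h.symm

end Module

variable (k) {A : Type*} [Ring A] [Algebra k⟦X⟧ A] [IsAdicComplete (hIdeal k) A]

/-- `e^{ħx} = ∑ₙ ħⁿ xⁿ / n!` in an `ħ`-adically complete algebra. -/
def hExp (x : A) : A :=
  hSum (k := k) fun n => (PowerSeries.C ((n.factorial : k)⁻¹) : k⟦X⟧) • x ^ n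

/-- `(e^{ħx} - e^{-ħy}) / ħ = ∑ₙ ħⁿ (xⁿ⁺¹ - (-y)ⁿ⁺¹) / (n+1)!`. -/
def hExpDiff (x y : A) : A :=
  hSum (k := k) fun n =>
    (PowerSeries.C (((n + 1).factorial : k)⁻¹) : k⟦X⟧) • (x ^ (n + 1) - (-y) ^ (n + 1))

theorem X_smul_hExpDiff (x y : A) :
    (PowerSeries.X : k⟦X⟧) • hExpDiff k x y = hExp k x - hExp k (-y) := by
  refine (IsHausdorff.eq_iff_smodEq (I := hIdeal k)).2 fun n => ?_
  refine ((hSum_smodEq _ n).symm.smul _).trans ?_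
  refine SModEq.trans ?_ (((hSum_smodEq _ (n + 1)).sub (hSum_smodEq _ (n + 1))).mono
    (Submodule.pow_smul_top_le _ _ n.le_succ))
  rw [← Finset.sum_sub_distrib, Finset.sum_range_succ', Finset.smul_sum]
  simp only [pow_zero, sub_self, add_zero, smul_smul, smul_sub, pow_succ', mul_assoc]
  rfl

theorem constantCoeff_hExpDiff (a : k⟦X⟧) :
    PowerSeries.constantCoeff (hExpDiff k a a) = 2 * PowerSeries.constantCoeff a := by
  have h := SModEq.sub_mem.1 (hSum_smodEq (k := k) (M := k⟦X⟧) (fun n =>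
    (PowerSeries.C (((n + 1).factorial : k)⁻¹) : k⟦X⟧) • (a ^ (n + 1) - (-a) ^ (n + 1))) 1)
  simp only [pow_one, smul_eq_mul, Ideal.mul_top, Ideal.mem_span_singleton,
    PowerSeries.X_dvd_iff] at h
  simp only [map_sub, sub_eq_zero] at h
  rw [hExpDiff]
  simp only [smul_eq_mul]
  rw [← h]
  simp
  ring

/-- The element `(e^{ħx} - e^{-ħy}) / (e^{ħd} - e^{-ħd})`, with a common factor `ħ` cancelled
in the numerator and in the denominator. -/
def hExpQuot (d : k⟦X⟧) (x y : A) : A := (hExpDiff k d d)⁻¹ • hExpDiff k x y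

theorem smul_hExpQuot [CharZero k] {d : k⟦X⟧} (hd : PowerSeries.constantCoeff d ≠ 0) (x y : A) :
    (hExp k d - hExp k (-d)) • hExpQuot k d x y = hExp k x - hExp k (-y) := by
  have h : PowerSeries.constantCoeff (hExpDiff k d d) ≠ 0 := by
    rw [constantCoeff_hExpDiff]
    exact mul_ne_zero two_ne_zero hd
  rw [← X_smul_hExpDiff, ← X_smul_hExpDiff, hExpQuot, smul_smul, smul_eq_mul, mul_assoc,
    PowerSeries.mul_inv_cancel _ h, mul_one]

end Exponential

/-! ### Topological Hopf algebras -/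

section Hopf

variable {k : Type*} [Field k] {H : Type*} [Ring H] [Algebra k⟦X⟧ H]

/-- `Δ ⊗ id : H ⊗ H → H ⊗̂ H ⊗̂ H`, i.e. `a ⊗ b ↦ (Δ(a) ⊗ 1) (1 ⊗ 1 ⊗ b)`. -/
def comulTensorId (Δ : H →ₗ[k⟦X⟧] Completion k (H ⊗[k⟦X⟧] H)) :
    H ⊗[k⟦X⟧] H →ₗ[k⟦X⟧] Completion k (H ⊗[k⟦X⟧] (H ⊗[k⟦X⟧] H)) :=
  TensorProduct.lift
    ((LinearMap.mul k⟦X⟧ (Completion k (H ⊗[k⟦X⟧] (H ⊗[k⟦X⟧] H)))).compl₁₂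
      (Completion.map (LinearMap.lTensor H ((TensorProduct.mk k⟦X⟧ H H).flip 1)) ∘ₗ Δ)
      (Completion.of ∘ₗ TensorProduct.mk k⟦X⟧ H (H ⊗[k⟦X⟧] H) 1 ∘ₗ TensorProduct.mk k⟦X⟧ H H 1))

/-- `id ⊗ Δ : H ⊗ H → H ⊗̂ H ⊗̂ H`, i.e. `a ⊗ b ↦ (a ⊗ 1 ⊗ 1) (1 ⊗ Δ(b))`. -/
def idTensorComul (Δ : H →ₗ[k⟦X⟧] Completion k (H ⊗[k⟦X⟧] H)) :
    H ⊗[k⟦X⟧] H →ₗ[k⟦X⟧] Completion k (H ⊗[k⟦X⟧] (H ⊗[k⟦X⟧] H)) :=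
  TensorProduct.lift
    ((LinearMap.mul k⟦X⟧ (Completion k (H ⊗[k⟦X⟧] (H ⊗[k⟦X⟧] H)))).compl₁₂
      (Completion.of ∘ₗ (TensorProduct.mk k⟦X⟧ H (H ⊗[k⟦X⟧] H)).flip 1)
      (Completion.map (TensorProduct.mk k⟦X⟧ H (H ⊗[k⟦X⟧] H) 1) ∘ₗ Δ))

variable (k H) in
/-- A structure of topological Hopf algebra on an `ħ`-adically complete `𝕜[[ħ]]`-algebra `H`,
with coproduct valued in the `ħ`-adically completed tensor product `H ⊗̂ H`. All maps are
`𝕜[[ħ]]`-linear, hence continuous. -/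
structure TopHopfStructure [IsAdicComplete (hIdeal k) H] where
  /-- the coproduct `Δ` -/
  comul : H →ₐ[k⟦X⟧] Completion k (H ⊗[k⟦X⟧] H)
  /-- the counit `ε` -/
  counit : H →ₐ[k⟦X⟧] k⟦X⟧
  /-- the antipode `S` -/
  antipode : H →ₗ[k⟦X⟧] H
  /-- `(Δ ⊗ id) Δ = (id ⊗ Δ) Δ` -/
  coassoc (x : H) :
    Completion.extend (comulTensorId comul.toLinearMap) (comul x) =
      Completion.extend (idTensorComul comul.toLinearMap) (comul x)
  /-- `(ε ⊗ id) Δ = id` -/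
  counit_left (x : H) :
    Completion.extend ((TensorProduct.lid k⟦X⟧ H).toLinearMap ∘ₗ
      LinearMap.rTensor H counit.toLinearMap) (comul x) = x
  /-- `(id ⊗ ε) Δ = id` -/
  counit_right (x : H) :
    Completion.extend ((TensorProduct.rid k⟦X⟧ H).toLinearMap ∘ₗ
      LinearMap.lTensor H counit.toLinearMap) (comul x) = x
  /-- `m (S ⊗ id) Δ = ε 1` -/
  antipode_left (x : H) :
    Completion.extend (LinearMap.mul' k⟦X⟧ H ∘ₗ LinearMap.rTensor H antipode) (comul x) =
      algebraMap k⟦X⟧ H (counit x)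
  /-- `m (id ⊗ S) Δ = ε 1` -/
  antipode_right (x : H) :
    Completion.extend (LinearMap.mul' k⟦X⟧ H ∘ₗ LinearMap.lTensor H antipode) (comul x) =
      algebraMap k⟦X⟧ H (counit x)

end Hopf

/-! ### Cartan data, multiparameter matrices and realizations -/

section Data

variable {I : Type*}

/-- Generalized Cartan matrices. -/
structure IsGCM (A : Matrix I I ℤ) : Prop where
  diag (i : I) : A i i = 2
  nonpos {i j : I} (h : i ≠ j) : A i j ≤ 0
  zero_symm {i j : I} (h : A i j = 0) : A j i = 0

/-- `D = diag(dᵢ)`, with positive integers `dᵢ`, symmetrizes `A`: the matrix `D A` is symmetric. -/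
structure IsSymmetrizer (A : Matrix I I ℤ) (d : I → ℕ) : Prop where
  pos (i : I) : 0 < d i
  symm (i j : I) : (d i : ℤ) * A i j = d j * A j i

variable {k : Type*} [Field k]

/-- `P` is of Cartan type, associated with `A` and `D`: `P + Pᵀ = 2 D A`. -/
def IsCartanType (A : Matrix I I ℤ) (d : I → ℕ) (P : Matrix I I k⟦X⟧) : Prop :=
  ∀ i j, P i j + P j i = 2 * (d i : k⟦X⟧) * (A i j : k⟦X⟧)

/-- A realization over `𝕜[[ħ]]`, with underlying module `𝔥`, of the matrix `P`. -/
structure Realization (P : Matrix I I k⟦X⟧) (h : Type*) [AddCommGroup h] [Module k⟦X⟧ h] where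
  /-- the elements `Tᵢ⁺` -/
  Tp : I → h
  /-- the elements `Tᵢ⁻` -/
  Tm : I → h
  /-- the functionals `αᵢ` -/
  α : I → Module.Dual k⟦X⟧ h
  α_Tp (i j : I) : α j (Tp i) = P i j
  α_Tm (i j : I) : α j (Tm i) = P j i
  /-- the classes of the `Sᵢ = (Tᵢ⁺ + Tᵢ⁻) / 2` are `𝕜`-linearly independent in `𝔥 / ħ𝔥` -/
  linearIndependent :
    letI : Module k (h ⧸ (hIdeal k • ⊤ : Submodule k⟦X⟧ h)) :=
      Module.compHom _ (PowerSeries.C : k →+* k⟦X⟧)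
    LinearIndependent k fun i =>
      (Submodule.Quotient.mk ((PowerSeries.C (2⁻¹ : k) : k⟦X⟧) • (Tp i + Tm i)) :
        h ⧸ (hIdeal k • ⊤ : Submodule k⟦X⟧ h))

end Data

/-! ### `q`-numbers -/

section QNumbers

variable {k : Type*} [Field k]

/-- `[n]_q = ∑_{s<n} q^{2s-n+1}` -/
def qInt (q : k⟦X⟧) (n : ℕ) : k⟦X⟧ := ∑ s ∈ Finset.range n, q ^ (2 * s) * q⁻¹ ^ (n - 1)

/-- `[n]_q! = [1]_q ⋯ [n]_q` -/
def qFactorial (q : k⟦X⟧) (n : ℕ) : k⟦X⟧ := ∏ s ∈ Finset.range n, qInt q (s + 1)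

/-- The `q`-binomial coefficient `[n]_q! / ([m]_q! [n-m]_q!)`; for `q` with constant term `1`
(in characteristic zero) the denominator is invertible in `𝕜[[ħ]]`. -/
def qBinom (q : k⟦X⟧) (n m : ℕ) : k⟦X⟧ :=
  qFactorial q n * (qFactorial q m * qFactorial q (n - m))⁻¹

end QNumbers

/-! ### Formal multiparameter quantized universal enveloping algebras -/

section Algebra

variable {k : Type*} [Field k] {I : Type*}

/-- `qᵢ = e^{ħ dᵢ}` -/
def qi (k : Type*) [Field k] (d : I → ℕ) (i : I) : k⟦X⟧ := hExp k (d i : k⟦X⟧)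

/-- `qᵢⱼ^{1/2} = e^{ħ pᵢⱼ / 2}` -/
def qHalf (P : Matrix I I k⟦X⟧) (i j : I) : k⟦X⟧ :=
  hExp k ((PowerSeries.C (2⁻¹ : k) : k⟦X⟧) * P i j)

/-- The coefficient `(-1)^m [1-aᵢⱼ choose m]_{qᵢ} qᵢⱼ^{m/2} qⱼᵢ^{-m/2}` of the quantum Serre
relations. -/
def serreCoeff (A : Matrix I I ℤ) (d : I → ℕ) (P : Matrix I I k⟦X⟧) (i j : I) (m : ℕ) : k⟦X⟧ :=
  (-1) ^ m * qBinom (qi k d i) (1 - A i j).toNat m * qHalf P i j ^ m * (qHalf P j i)⁻¹ ^ m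

section Free

variable (k I) (h : Type*) [AddCommGroup h] [Module k⟦X⟧ h]

/-- The module spanned by the generators: `𝔥`, the `Eᵢ` and the `Fᵢ`. -/
abbrev Generators : Type _ := h × (I →₀ k⟦X⟧) × (I →₀ k⟦X⟧)

/-- The free `ħ`-adically complete unital associative algebra generated by the module `𝔥` and
the elements `Eᵢ`, `Fᵢ`. -/
abbrev FreeAlg : Type _ := Completion k (TensorAlgebra k⟦X⟧ (Generators k I h))

variable {k I h}

/-- The generator `T ∈ 𝔥`. -/
def freeT (T : h) : FreeAlg k I h :=
  Completion.of (TensorAlgebra.ι k⟦X⟧ ((T, 0, 0) : Generators k I h))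

/-- The generator `Eᵢ`. -/
def freeE (i : I) : FreeAlg k I h :=
  Completion.of (TensorAlgebra.ι k⟦X⟧ ((0, Finsupp.single i 1, 0) : Generators k I h))

/-- The generator `Fᵢ`. -/
def freeF (i : I) : FreeAlg k I h :=
  Completion.of (TensorAlgebra.ι k⟦X⟧ ((0, 0, Finsupp.single i 1) : Generators k I h))

end Free

variable {h : Type*} [AddCommGroup h] [Module k⟦X⟧ h]

/-- The defining relations. -/
inductive Rel (A : Matrix I I ℤ) (d : I → ℕ) {P : Matrix I I k⟦X⟧} (ρ : Realization P h) :
    FreeAlg k I h → FreeAlg k I h → Prop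
  | TE (T : h) (j : I) :
      Rel A d ρ (freeT T * freeE j - freeE j * freeT T) (ρ.α j T • freeE j)
  | TF (T : h) (j : I) :
      Rel A d ρ (freeT T * freeF j - freeF j * freeT T) (-(ρ.α j T • freeF j))
  | TT (T' T'' : h) : Rel A d ρ (freeT T' * freeT T'') (freeT T'' * freeT T')
  | EF_same (i : I) :
      Rel A d ρ (freeE i * freeF i - freeF i * freeE i)
        (hExpQuot k (d i : k⟦X⟧) (freeT (ρ.Tp i)) (freeT (ρ.Tm i)))
  | EF_ne (i j : I) (hij : i ≠ j) : Rel A d ρ (freeE i * freeF j - freeF j * freeE i) 0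
  | serreE (i j : I) (hij : i ≠ j) :
      Rel A d ρ (∑ m ∈ Finset.range ((1 - A i j).toNat + 1), serreCoeff A d P i j m •
        (freeE i ^ ((1 - A i j).toNat - m) * freeE j * freeE i ^ m)) 0
  | serreF (i j : I) (hij : i ≠ j) :
      Rel A d ρ (∑ m ∈ Finset.range ((1 - A i j).toNat + 1), serreCoeff A d P i j m •
        (freeF i ^ m * freeF j * freeF i ^ ((1 - A i j).toNat - m))) 0

/-- The formal multiparameter quantized universal enveloping algebra: the `ħ`-adically complete
algebra presented by the above generators and relations, i.e. the `ħ`-adic completion of the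
quotient of the free complete algebra by the two-sided ideal generated by the relations
(equivalently, the quotient of the free complete algebra by the closure of that ideal). -/
abbrev UPh (A : Matrix I I ℤ) (d : I → ℕ) {P : Matrix I I k⟦X⟧} (ρ : Realization P h) :
    Type _ :=
  Completion k (RingQuot (Rel A d ρ))

variable (A : Matrix I I ℤ) (d : I → ℕ) {P : Matrix I I k⟦X⟧} (ρ : Realization P h)

/-- The canonical map from the free complete algebra. -/
def toUPh : FreeAlg k I h →ₐ[k⟦X⟧] UPh A d ρ :=
  Completion.ofAlgHom.comp (RingQuot.mkAlgHom k⟦X⟧ (Rel A d ρ))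

/-- `T`, as an element of the formal multiparameter quantized universal enveloping algebra. -/
def genT (T : h) : UPh A d ρ := toUPh A d ρ (freeT T)

/-- The generator `Eᵢ` of the formal multiparameter quantized universal enveloping algebra. -/
def genE (i : I) : UPh A d ρ := toUPh A d ρ (freeE i)

/-- The generator `Fᵢ` of the formal multiparameter quantized universal enveloping algebra. -/
def genF (i : I) : UPh A d ρ := toUPh A d ρ (freeF i)

end Algebra

end FoMpQUEA

end

open FoMpQUEA

noncomputable section

namespace FoMpQUEA

/-! ### Linear maps and the `ħ`-adic topology -/

section Topology

variable {k : Type*} [Field k]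
  {M : Type*} [AddCommGroup M] [Module k⟦X⟧ M] {N : Type*} [AddCommGroup N] [Module k⟦X⟧ N]

/-! `UPh` has a universal property: elements of an `ħ`-adically complete algebra that satisfy the
defining relations (a `RelSystem`) determine a homomorphism out of it (`RelSystem.lift`). So `Δ`,
`ε` and `S` arise by exhibiting such elements in `H ⊗̂ H`, in `𝕜[[ħ]]` and in `Hᵐᵒᵖ`. Every
`𝕜[[ħ]]`-linear map is `ħ`-adically continuous and the generators span a dense subalgebra
(`isHDense_adjoin`), so the Hopf axioms need only be checked on `T`, `Eᵢ`, `Fᵢ`. There they are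
immediate, because these elements are skew primitive for the grouplike elements `e^{ħT}`.

The work lies in the relations. For `[Eᵢ, Fᵢ]`, the algebra is not known to be `ħ`-torsion free, so
identities between exponentials are proved after division by `ħ`, through the cocycle rule
`hExpm1_add`.

For the quantum Serre relations, put `n = -aᵢⱼ`. The Gaussian binomial theorem writes the Serre
polynomial as an iterated skew commutator `Zᵣ₊₁ = x Zᵣ - q²ʳ s Zᵣ x`, where `qⁿ s` is the parameter
`(qᵢⱼ/qⱼᵢ)^{1/2}`. Its `q ↔ q⁻¹` symmetry gives a second such form, with `s'` in place of `s`. For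
Cartan type, `s = e^{ħpᵢⱼ}` and `s' = e^{-ħpⱼᵢ}`. These are exactly the factors that appear when the
summands of `Δ(Eᵢ)` move past those of `Δ(Eⱼ)`, so all mixed terms vanish (`qSerre_add`). For the
antipode, the second form, read in the opposite algebra, is a multiple of the first
(`exists_unop_adIter_eq_smul`). -/

theorem smodEq_map (f : M →ₗ[k⟦X⟧] N) {J : Ideal k⟦X⟧} {x y : M}
    (h : x ≡ y [SMOD (J • ⊤ : Submodule k⟦X⟧ M)]) :
    f x ≡ f y [SMOD (J • ⊤ : Submodule k⟦X⟧ N)] := by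
  refine (h.map f).mono ?_
  rw [Submodule.map_smul'']
  exact Submodule.smul_mono le_rfl le_top

theorem smodEq_mul {A : Type*} [Ring A] [Algebra k⟦X⟧ A] {J : Ideal k⟦X⟧} {a a' b b' : A}
    (ha : a ≡ a' [SMOD (J • ⊤ : Submodule k⟦X⟧ A)])
    (hb : b ≡ b' [SMOD (J • ⊤ : Submodule k⟦X⟧ A)]) :
    a * b ≡ a' * b' [SMOD (J • ⊤ : Submodule k⟦X⟧ A)] :=
  (smodEq_map (LinearMap.mulRight k⟦X⟧ b) ha).trans (smodEq_map (LinearMap.mulLeft k⟦X⟧ a') hb)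

theorem X_pow_smul_mem {n m : ℕ} (h : n ≤ m) (x : M) :
    (PowerSeries.X : k⟦X⟧) ^ m • x ∈ (hIdeal k ^ n • ⊤ : Submodule k⟦X⟧ M) :=
  Submodule.smul_mem_smul (Ideal.pow_le_pow_right h
    (Ideal.pow_mem_pow (Ideal.mem_span_singleton_self _) m)) trivial

theorem isAdicComplete_of_linearEquiv (e : M ≃ₗ[k⟦X⟧] N) [IsAdicComplete (hIdeal k) M] :
    IsAdicComplete (hIdeal k) N where
  haus' x hx := by
    have : e.symm x = 0 := (IsHausdorff.eq_iff_smodEq (I := hIdeal k)).2 fun n => by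
      simpa using smodEq_map e.symm.toLinearMap (hx n)
    simpa using this
  prec' f hf := by
    obtain ⟨L, hL⟩ := IsPrecomplete.prec' (I := hIdeal k) (fun n => e.symm (f n))
      fun h => smodEq_map e.symm.toLinearMap (hf h)
    exact ⟨e L, fun n => by simpa using smodEq_map e.toLinearMap (hL n)⟩

/-- The antipode is obtained as an algebra homomorphism into the opposite algebra, so this algebra
has to be complete for the universal property to apply. -/
instance {H : Type*} [Ring H] [Algebra k⟦X⟧ H] [IsAdicComplete (hIdeal k) H] :
    IsAdicComplete (hIdeal k) Hᵐᵒᵖ :=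
  isAdicComplete_of_linearEquiv (MulOpposite.opLinearEquiv k⟦X⟧)

/-- A submodule that is dense for the `ħ`-adic topology. -/
def IsHDense (S : Submodule k⟦X⟧ M) : Prop :=
  ∀ (n : ℕ) (x : M), ∃ y ∈ S, x ≡ y [SMOD (hIdeal k ^ n • ⊤ : Submodule k⟦X⟧ M)]

/-- Continuity is automatic, since a linear map sends `ħⁿM` into `ħⁿN`. -/
theorem IsHDense.linearMap_ext {S : Submodule k⟦X⟧ M} (hS : IsHDense S)
    [IsHausdorff (hIdeal k) N] {f g : M →ₗ[k⟦X⟧] N} (h : ∀ y ∈ S, f y = g y) : f = g := by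
  ext x
  refine (IsHausdorff.eq_iff_smodEq (I := hIdeal k)).2 fun n => ?_
  obtain ⟨y, hy, hxy⟩ := hS n x
  exact (smodEq_map f hxy).trans (h y hy ▸ (smodEq_map g hxy).symm)

theorem IsHDense.map {S : Submodule k⟦X⟧ M} (hS : IsHDense S) (f : M →ₗ[k⟦X⟧] N)
    (hf : IsHDense (LinearMap.range f)) : IsHDense (S.map f) := by
  intro n x
  obtain ⟨_, ⟨y, rfl⟩, hxy⟩ := hf n x
  obtain ⟨z, hz, hyz⟩ := hS n y
  exact ⟨f z, Submodule.mem_map_of_mem hz, hxy.trans (smodEq_map f hyz)⟩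

theorem isHDense_range_of_surjective {f : M →ₗ[k⟦X⟧] N} (hf : Function.Surjective f) :
    IsHDense (LinearMap.range f) :=
  fun _ x => ⟨x, hf x, SModEq.rfl⟩

end Topology

/-! ### Density of an algebra in its completion and extension of homomorphisms -/

namespace Completion

variable {k : Type*} [Field k] {A : Type*} [Ring A] [Algebra k⟦X⟧ A]
  {B : Type*} [Ring B] [Algebra k⟦X⟧ B]
  {N : Type*} [AddCommGroup N] [Module k⟦X⟧ N]

/-- The ideal `(ħ)` is finitely generated, so the kernel of the projection to `A / ħⁿA` is `ħⁿ`
times the completion. -/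
theorem isHDense_range_of :
    IsHDense (LinearMap.range (of : A →ₗ[k⟦X⟧] Completion k A)) := by
  intro n x
  obtain ⟨a, ha⟩ := exists_rep x n
  refine ⟨of a, ⟨a, rfl⟩, SModEq.sub_mem.2 ?_⟩
  have h := AdicCompletion.pow_smul_top_eq_ker_eval (I := hIdeal k) (M := A) (n := n)
    ⟨{PowerSeries.X}, by simp⟩
  have h' : x - of a ∈ LinearMap.ker (proj (k := k) (A := A) n) := by
    rw [LinearMap.mem_ker, map_sub, ← ha, proj_of, sub_self]
  exact h.ge h'

theorem linearMap_ext [IsHausdorff (hIdeal k) N] {f g : Completion k A →ₗ[k⟦X⟧] N}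
    (h : ∀ a : A, f (of a) = g (of a)) : f = g :=
  isHDense_range_of.linearMap_ext (by rintro _ ⟨a, rfl⟩; exact h a)

theorem of_mul (a b : A) : (of (a * b) : Completion k A) = of a * of b := rfl

theorem of_one : (of (1 : A) : Completion k A) = 1 := rfl

@[simp]
theorem ofAlgHom_apply (a : A) : (ofAlgHom a : Completion k A) = of a := rfl

variable [IsAdicComplete (hIdeal k) B]

/-- The extension to the completion of an algebra homomorphism with complete target. -/
def extendAlgHom (f : A →ₐ[k⟦X⟧] B) : Completion k A →ₐ[k⟦X⟧] B :=
  AlgHom.ofLinearMap (extend f.toLinearMap)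
    (by rw [← of_one, extend_of]; exact map_one f)
    (by
      -- Multiplicativity is an equality of bilinear maps; density of `A` is used once for each
      -- factor.
      have h : (LinearMap.mul k⟦X⟧ (Completion k A)).compr₂ (extend f.toLinearMap) =
          (LinearMap.mul k⟦X⟧ B).compl₁₂ (extend f.toLinearMap) (extend f.toLinearMap) := by
        ext x y
        revert y
        rw [← LinearMap.ext_iff]
        refine linearMap_ext fun b => ?_
        have h' : extend f.toLinearMap ∘ₗ LinearMap.mulRight k⟦X⟧ (of b) =
            LinearMap.mulRight k⟦X⟧ (extend f.toLinearMap (of b)) ∘ₗ extend f.toLinearMap := by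
          refine linearMap_ext fun a => ?_
          simp only [LinearMap.comp_apply, LinearMap.mulRight_apply, ← of_mul, extend_of]
          exact map_mul f a b
        exact LinearMap.congr_fun h' x
      exact fun x y => LinearMap.congr_fun₂ h x y)

@[simp]
theorem extendAlgHom_of (f : A →ₐ[k⟦X⟧] B) (a : A) : extendAlgHom f (of a) = f a :=
  extend_of f.toLinearMap a

/-- The homomorphism induced on completions by an algebra homomorphism. -/
def mapAlgHom {B : Type*} [Ring B] [Algebra k⟦X⟧ B] (f : A →ₐ[k⟦X⟧] B) :
    Completion k A →ₐ[k⟦X⟧] Completion k B :=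
  extendAlgHom (ofAlgHom.comp f)

@[simp]
theorem mapAlgHom_of {B : Type*} [Ring B] [Algebra k⟦X⟧ B] (f : A →ₐ[k⟦X⟧] B) (a : A) :
    mapAlgHom (k := k) f (of a) = of (f a) :=
  extendAlgHom_of _ a

/-- Elements commuting with the image of `A` commute with the image of its completion. -/
theorem commute_extendAlgHom {f : A →ₐ[k⟦X⟧] B} {y : B} (h : ∀ a, Commute (f a) y)
    (x : Completion k A) : Commute (extendAlgHom f x) y := by
  have h' : LinearMap.mulRight k⟦X⟧ y ∘ₗ (extendAlgHom f).toLinearMap =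
      LinearMap.mulLeft k⟦X⟧ y ∘ₗ (extendAlgHom f).toLinearMap :=
    linearMap_ext fun a => by simpa using (h a).eq
  exact LinearMap.congr_fun h' x

omit [IsAdicComplete (hIdeal k) B] in
theorem commute_mapAlgHom {f : A →ₐ[k⟦X⟧] B} {y : B} (h : ∀ a, Commute (f a) y)
    (x : Completion k A) : Commute (mapAlgHom f x) (ofAlgHom (k := k) y) :=
  commute_extendAlgHom (fun a => (h a).map ofAlgHom) x

end Completion

/-! ### Sums and exponentials in complete algebras -/

section Exponential

variable {k : Type*} [Field k]

section Module

variable {M : Type*} [AddCommGroup M] [Module k⟦X⟧ M] [IsAdicComplete (hIdeal k) M]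
  {N : Type*} [AddCommGroup N] [Module k⟦X⟧ N] [IsAdicComplete (hIdeal k) N]

theorem hSum_unique {x : ℕ → M} {y : M} (h : ∀ n,
    ∑ m ∈ Finset.range n, (PowerSeries.X : k⟦X⟧) ^ m • x m ≡ y
      [SMOD (hIdeal k ^ n • ⊤ : Submodule k⟦X⟧ M)]) : hSum (k := k) x = y :=
  (IsHausdorff.eq_iff_smodEq (I := hIdeal k)).2 fun n => (hSum_smodEq x n).symm.trans (h n)

theorem map_hSum (f : M →ₗ[k⟦X⟧] N) (x : ℕ → M) :
    f (hSum (k := k) x) = hSum (k := k) fun n => f (x n) := by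
  refine (hSum_unique fun n => ?_).symm
  simpa using smodEq_map f (hSum_smodEq (k := k) x n)

theorem hSum_add (x y : ℕ → M) :
    hSum (k := k) (fun n => x n + y n) = hSum (k := k) x + hSum (k := k) y := by
  refine hSum_unique fun n => ?_
  simp only [smul_add, Finset.sum_add_distrib]
  exact (hSum_smodEq x n).add (hSum_smodEq y n)

theorem hSum_sub (x y : ℕ → M) :
    hSum (k := k) (fun n => x n - y n) = hSum (k := k) x - hSum (k := k) y := by
  refine hSum_unique fun n => ?_
  simp only [smul_sub, Finset.sum_sub_distrib]
  exact (hSum_smodEq x n).sub (hSum_smodEq y n)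

theorem hSum_eq_zero_add (x : ℕ → M) :
    hSum (k := k) x = x 0 + (PowerSeries.X : k⟦X⟧) • hSum (k := k) (fun n => x (n + 1)) := by
  refine hSum_unique fun n => ?_
  have h := (hSum_smodEq (k := k) (fun n => x (n + 1)) n).smul (PowerSeries.X : k⟦X⟧)
  refine SModEq.trans ?_ (SModEq.rfl.add h)
  have h2 : ∑ m ∈ Finset.range (n + 1), (PowerSeries.X : k⟦X⟧) ^ m • x m =
      x 0 + (PowerSeries.X : k⟦X⟧) •
        ∑ m ∈ Finset.range n, (PowerSeries.X : k⟦X⟧) ^ m • x (m + 1) := by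
    rw [Finset.sum_range_succ', Finset.smul_sum]
    simp [smul_smul, pow_succ', add_comm]
  rw [← h2, Finset.sum_range_succ, SModEq.comm, SModEq.sub_mem, add_sub_cancel_left]
  exact X_pow_smul_mem le_rfl _

end Module

variable {A : Type*} [Ring A] [Algebra k⟦X⟧ A] [IsAdicComplete (hIdeal k) A]
  {B : Type*} [Ring B] [Algebra k⟦X⟧ B] [IsAdicComplete (hIdeal k) B]

/-- Modulo `ħⁿ`, the product of the truncated sums exceeds the truncated Cauchy product by the terms
of the square with `p.1 + p.2 ≥ n`, all divisible by `ħⁿ`. -/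
theorem hSum_mul_hSum (x y : ℕ → A) :
    hSum (k := k) x * hSum (k := k) y =
      hSum (k := k) fun n => ∑ p ∈ Finset.HasAntidiagonal.antidiagonal n, x p.1 * y p.2 := by
  refine (hSum_unique fun n => ?_).symm
  refine SModEq.trans ?_ (smodEq_mul (hSum_smodEq x n) (hSum_smodEq y n))
  rw [Finset.sum_mul_sum, ← Finset.sum_product', SModEq.comm, SModEq.sub_mem]
  have h1 : ∑ m ∈ Finset.range n, (PowerSeries.X : k⟦X⟧) ^ m •
        ∑ p ∈ Finset.HasAntidiagonal.antidiagonal m, x p.1 * y p.2 =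
      ∑ p ∈ (Finset.range n ×ˢ Finset.range n) with p.1 + p.2 < n,
        ((PowerSeries.X : k⟦X⟧) ^ p.1 • x p.1) * ((PowerSeries.X : k⟦X⟧) ^ p.2 • y p.2) := by
    simp only [Finset.smul_sum]
    rw [Finset.sum_sigma']
    refine Finset.sum_bij' (fun s _ => s.2) (fun p _ => ⟨p.1 + p.2, p⟩) ?_ ?_ ?_ ?_ ?_
    · rintro ⟨m, a, b⟩ h
      simp at h ⊢
      omega
    · rintro ⟨a, b⟩ h
      simp at h ⊢
      omega
    · rintro ⟨m, a, b⟩ h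
      simp at h ⊢
      omega
    · rintro ⟨a, b⟩ h
      rfl
    · rintro ⟨m, a, b⟩ h
      simp at h ⊢
      rw [← h.2, smul_smul, ← pow_add, add_comm b a]
  rw [h1, ← Finset.sum_filter_add_sum_filter_not (Finset.range n ×ˢ Finset.range n)
    (fun p => p.1 + p.2 < n), add_sub_cancel_left]
  refine Submodule.sum_mem _ fun p hp => ?_
  rw [smul_mul_smul_comm, ← pow_add]
  exact X_pow_smul_mem (by simpa using (Finset.mem_filter.1 hp).2) _

variable (k) in
/-- `(e^{ħx} - 1) / ħ = ∑ₙ ħⁿ xⁿ⁺¹ / (n+1)!`. -/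
def hExpm1 (x : A) : A :=
  hSum (k := k) fun n => (PowerSeries.C (((n + 1).factorial : k)⁻¹) : k⟦X⟧) • x ^ (n + 1)

theorem map_hExp (f : A →ₐ[k⟦X⟧] B) (x : A) : f (hExp k x) = hExp k (f x) := by
  have := map_hSum f.toLinearMap
    (fun n => (PowerSeries.C ((n.factorial : k)⁻¹) : k⟦X⟧) • x ^ n)
  simpa [hExp] using this

theorem map_hExpm1 (f : A →ₐ[k⟦X⟧] B) (x : A) : f (hExpm1 k x) = hExpm1 k (f x) := by
  have := map_hSum f.toLinearMap
    (fun n => (PowerSeries.C (((n + 1).factorial : k)⁻¹) : k⟦X⟧) • x ^ (n + 1))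
  simpa [hExpm1] using this

/-- Working with `hExpm1` avoids cancelling `ħ`, which may be a zero divisor on `A`. -/
theorem hExpDiff_eq (x y : A) : hExpDiff k x y = hExpm1 k x - hExpm1 k (-y) := by
  simp only [hExpDiff, hExpm1, smul_sub, hSum_sub]

theorem hExp_eq_one_add (x : A) : hExp k x = 1 + (PowerSeries.X : k⟦X⟧) • hExpm1 k x := by
  rw [hExp, hSum_eq_zero_add]
  simp [hExpm1]

theorem map_hExpDiff (f : A →ₐ[k⟦X⟧] B) (x y : A) :
    f (hExpDiff k x y) = hExpDiff k (f x) (f y) := by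
  simp only [hExpDiff_eq, map_sub, map_hExpm1, map_neg]

theorem map_hExpQuot (f : A →ₐ[k⟦X⟧] B) (c : k⟦X⟧) (x y : A) :
    f (hExpQuot k c x y) = hExpQuot k c (f x) (f y) := by
  simp only [hExpQuot, map_smul, map_hExpDiff]

@[simp]
theorem hExpm1_zero : hExpm1 k (0 : A) = 0 := by
  rw [hExpm1]
  refine hSum_unique fun n => ?_
  simp

@[simp]
theorem hExp_zero : hExp k (0 : A) = 1 := by
  simp [hExp_eq_one_add]

/-- Elements intertwining `x` and `y` intertwine their exponentials. -/
theorem hExp_mul_of_mul_eq {x y z : A} (h : x * z = z * y) : hExp k x * z = z * hExp k y := by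
  have h' : ∀ n, x ^ n * z = z * y ^ n := fun n => (SemiconjBy.pow_right (a := z) h.symm n).symm
  have h1 := map_hSum (LinearMap.mulRight k⟦X⟧ z)
    (fun n => (PowerSeries.C ((n.factorial : k)⁻¹) : k⟦X⟧) • x ^ n)
  have h2 := map_hSum (LinearMap.mulLeft k⟦X⟧ z)
    (fun n => (PowerSeries.C ((n.factorial : k)⁻¹) : k⟦X⟧) • y ^ n)
  simp only [LinearMap.mulRight_apply, LinearMap.mulLeft_apply, smul_mul_assoc, mul_smul_comm,
    h'] at h1 h2
  exact h1.trans h2.symm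

theorem hExpm1_mul_of_mul_eq {x y z : A} (h : x * z = z * y) :
    hExpm1 k x * z = z * hExpm1 k y := by
  have h' : ∀ n, x ^ n * z = z * y ^ n := fun n => (SemiconjBy.pow_right (a := z) h.symm n).symm
  have h1 := map_hSum (LinearMap.mulRight k⟦X⟧ z)
    (fun n => (PowerSeries.C (((n + 1).factorial : k)⁻¹) : k⟦X⟧) • x ^ (n + 1))
  have h2 := map_hSum (LinearMap.mulLeft k⟦X⟧ z)
    (fun n => (PowerSeries.C (((n + 1).factorial : k)⁻¹) : k⟦X⟧) • y ^ (n + 1))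
  simp only [LinearMap.mulRight_apply, LinearMap.mulLeft_apply, smul_mul_assoc, mul_smul_comm,
    h'] at h1 h2
  exact h1.trans h2.symm

theorem _root_.Commute.hExp_left {x y : A} (h : Commute x y) : Commute (hExp k x) y :=
  hExp_mul_of_mul_eq h

theorem _root_.Commute.hExp_right {x y : A} (h : Commute x y) : Commute x (hExp k y) :=
  h.symm.hExp_left.symm

theorem _root_.Commute.hExpm1_left {x y : A} (h : Commute x y) : Commute (hExpm1 k x) y :=
  hExpm1_mul_of_mul_eq h

theorem _root_.Commute.hExpm1_right {x y : A} (h : Commute x y) : Commute x (hExpm1 k y) :=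
  h.symm.hExpm1_left.symm

variable [CharZero k]

/-- This is `e^{x+y} - 1 = (e^x - 1) + e^x (e^y - 1)` divided by `ħ`. It is proved coefficientwise
from the binomial expansion of `(x + y)ⁿ⁺¹`. -/
theorem hExpm1_add {x y : A} (h : Commute x y) :
    hExpm1 k (x + y) = hExpm1 k x + hExp k x * hExpm1 k y := by
  rw [hExp, hExpm1, hExpm1, hExpm1, hSum_mul_hSum, ← hSum_add]
  congr 1
  funext n
  have hf : ∀ n : ℕ, (n.factorial : k) ≠ 0 := fun n => by exact_mod_cast n.factorial_ne_zero
  have key : ∀ p ∈ Finset.HasAntidiagonal.antidiagonal (n + 1),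
      (PowerSeries.C (((n + 1).factorial : k)⁻¹) : k⟦X⟧) •
        ((n + 1).choose p.1 • (x ^ p.1 * y ^ p.2)) =
      ((PowerSeries.C ((p.1.factorial : k)⁻¹) : k⟦X⟧) • x ^ p.1) *
        ((PowerSeries.C ((p.2.factorial : k)⁻¹) : k⟦X⟧) • y ^ p.2) := by
    rintro ⟨a, b⟩ hp
    rw [Finset.HasAntidiagonal.mem_antidiagonal] at hp
    simp only at hp ⊢
    have hab : ((a + b).choose a : k) * a.factorial * b.factorial = (a + b).factorial := by
      rw [Nat.choose_symm_add]
      exact_mod_cast Nat.add_choose_mul_factorial_mul_factorial a b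
    rw [smul_mul_smul_comm, ← Nat.cast_smul_eq_nsmul k⟦X⟧, smul_smul, ← map_mul,
      ← map_natCast (PowerSeries.C (R := k)), ← map_mul, ← hp]
    congr 2
    have := hf a
    have := hf b
    have := hf (a + b)
    field_simp
    linear_combination hab
  -- The term without `y` is split off; it gives the first summand.
  rw [h.add_pow', Finset.smul_sum, Finset.sum_congr rfl key, Finset.Nat.antidiagonal_succ',
    Finset.sum_cons, Finset.sum_map]
  simp

theorem hExp_add {x y : A} (h : Commute x y) : hExp k (x + y) = hExp k x * hExp k y := by
  rw [hExp_eq_one_add (x + y), hExpm1_add h, hExp_eq_one_add y, smul_add, ← add_assoc,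
    ← hExp_eq_one_add, mul_add, mul_one, mul_smul_comm]

theorem hExp_mul_hExp_neg (x : A) : hExp k x * hExp k (-x) = 1 := by
  rw [← hExp_add (Commute.refl x).neg_right, add_neg_cancel, hExp_zero]

theorem hExp_neg_mul_hExp (x : A) : hExp k (-x) * hExp k x = 1 := by
  rw [← hExp_add (Commute.refl x).neg_left, neg_add_cancel, hExp_zero]

/-- `e^{ħx} z = e^{ħc} z e^{ħx}` if `x z - z x = c z` with a scalar `c`. -/
theorem hExp_mul_of_commutator {x z : A} {c : k⟦X⟧} (h : x * z - z * x = c • z) :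
    hExp k x * z = hExp k c • (z * hExp k x) := by
  -- Moving past `z` shifts `x` by the central element `c`, whose exponential then splits off as a
  -- scalar.
  have h' : x * z = z * (algebraMap k⟦X⟧ A c + x) := by
    rw [mul_add, ← Algebra.commutes, ← Algebra.smul_def, ← h, sub_add_cancel]
  rw [hExp_mul_of_mul_eq h', hExp_add (Algebra.commutes c x),
    show hExp k (algebraMap k⟦X⟧ A c) = algebraMap k⟦X⟧ A (hExp k c) from
      (map_hExp (Algebra.ofId k⟦X⟧ A) c).symm, ← mul_assoc, ← Algebra.commutes, mul_assoc,
    ← Algebra.smul_def]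

/-- The coproduct of the right-hand side of the relation between `Eᵢ` and `Fᵢ`. -/
theorem hExpDiff_add_add {x₁ x₂ y₁ y₂ : A} (hx : Commute x₁ x₂) (hy : Commute y₁ y₂)
    (hxy : Commute x₁ y₂) :
    hExpDiff k (x₁ + x₂) (y₁ + y₂) =
      hExpDiff k x₁ y₁ * hExp k (-y₂) + hExp k x₁ * hExpDiff k x₂ y₂ := by
  have hy' : Commute (-y₂) (-y₁) := hy.symm.neg_left.neg_right
  have h1 : hExp k (-y₂) * hExpm1 k (-y₁) = hExpm1 k (-y₁) * hExp k (-y₂) :=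
    hy'.hExp_left.hExpm1_right
  have h2 : Commute (hExpm1 k x₁) (hExpm1 k (-y₂)) :=
    hxy.neg_right.hExpm1_left.hExpm1_right
  -- The identity telescopes through `e^{ħx₁} e^{-ħy₂}`. After expansion in `hExpm1`, the two terms
  -- `ħ · hExpm1 x₁ · hExpm1 (-y₂)` on the right cancel.
  simp only [hExpDiff_eq, neg_add_rev]
  rw [hExpm1_add hx, hExpm1_add hy', h1, hExp_eq_one_add x₁, hExp_eq_one_add (-y₂)]
  simp only [sub_mul, mul_sub, add_mul, mul_add, one_mul, mul_one, smul_mul_assoc, mul_smul_comm,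
    smul_sub]
  abel

/-- The antipode of the right-hand side of the relation between `Eᵢ` and `Fᵢ`. -/
theorem hExpDiff_neg_neg (x y : A) :
    hExpDiff k (-x) (-y) = -(hExp k (-x) * hExpDiff k x y * hExp k y) := by
  have hx : hExp k (-x) * hExpm1 k x = -hExpm1 k (-x) := by
    have := hExpm1_add (k := k) (Commute.refl x).neg_left
    rw [neg_add_cancel, hExpm1_zero] at this
    exact (neg_eq_of_add_eq_zero_right this.symm).symm
  have hy : hExpm1 k (-y) * hExp k y = -hExpm1 k y := by
    have := hExpm1_add (k := k) (Commute.refl y).neg_right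
    rw [add_neg_cancel, hExpm1_zero,
      (show Commute (hExp k y) (hExpm1 k (-y)) from
        (Commute.refl y).neg_right.hExp_left.hExpm1_right).eq] at this
    exact (neg_eq_of_add_eq_zero_right this.symm).symm
  simp only [hExpDiff_eq, neg_neg]
  rw [mul_sub, sub_mul, hx, mul_assoc _ _ (hExp k y), hy, hExp_eq_one_add y,
    hExp_eq_one_add (-x)]
  simp only [add_mul, mul_add, one_mul, mul_one, smul_mul_assoc, mul_smul_comm, neg_mul, mul_neg,
    smul_neg]
  abel

theorem hExpQuot_add_add (c : k⟦X⟧) {x₁ x₂ y₁ y₂ : A} (hx : Commute x₁ x₂) (hy : Commute y₁ y₂)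
    (hxy : Commute x₁ y₂) :
    hExpQuot k c (x₁ + x₂) (y₁ + y₂) =
      hExpQuot k c x₁ y₁ * hExp k (-y₂) + hExp k x₁ * hExpQuot k c x₂ y₂ := by
  simp only [hExpQuot, hExpDiff_add_add hx hy hxy, smul_add, smul_mul_assoc, mul_smul_comm]

theorem hExpQuot_neg_neg (c : k⟦X⟧) (x y : A) :
    hExpQuot k c (-x) (-y) = -(hExp k (-x) * hExpQuot k c x y * hExp k y) := by
  simp only [hExpQuot, hExpDiff_neg_neg, smul_neg, smul_mul_assoc, mul_smul_comm]

end Exponential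

/-! ### Iterated skew commutators -/

section SkewCommutator

variable {R : Type*} [CommRing R] {B : Type*} [Ring B] [Algebra R B]

/-- The iterated skew commutators `Z₀ = y`, `Zᵣ₊₁ = x Zᵣ - μᵣ Zᵣ x`. -/
def adIter (μ : ℕ → R) (x y : B) : ℕ → B
  | 0 => y
  | r + 1 => x * adIter μ x y r - μ r • (adIter μ x y r * x)

/-- `Zᵣ` is homogeneous, with `r` factors `a` and one factor `y`: each `a` contributes `Q` and `y`
contributes `s`. -/
theorem mul_adIter {Q s : R} {a b y : B} (hba : b * a = Q • (a * b)) (hby : b * y = s • (y * b))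
    (μ : ℕ → R) (r : ℕ) : b * adIter μ a y r = (Q ^ r * s) • (adIter μ a y r * b) := by
  induction r with
  | zero => simpa [adIter] using hby
  | succ r ih =>
    simp only [adIter]
    rw [mul_sub, sub_mul, mul_smul_comm, ← mul_assoc, hba, smul_mul_assoc, mul_assoc, ih,
      ← mul_assoc b, ih, smul_mul_assoc, mul_assoc _ b a, hba]
    simp only [smul_mul_assoc, mul_smul_comm, smul_smul, smul_sub, mul_assoc]
    congr 2 <;> ring

/-- If `b` skew commutes with `a` and `y`, then `b` does not contribute to the iterated skew
commutators of `a + b` with `y`. -/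
theorem adIter_add_left {Q s : R} {a b y : B} (hba : b * a = Q • (a * b))
    (hby : b * y = s • (y * b)) (r : ℕ) :
    adIter (fun r => Q ^ r * s) (a + b) y r = adIter (fun r => Q ^ r * s) a y r := by
  induction r with
  | zero => rfl
  | succ r ih =>
    simp only [adIter, ih]
    -- The factor that `b` picks up in passing `Zᵣ` is `μᵣ` itself, so `b Zᵣ - μᵣ Zᵣ b` vanishes.
    rw [add_mul, mul_add, mul_adIter hba hby, smul_add]
    abel

theorem adIter_add_right (μ : ℕ → R) (x y z : B) (r : ℕ) :
    adIter μ x (y + z) r = adIter μ x y r + adIter μ x z r := by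
  induction r with
  | zero => rfl
  | succ r ih =>
    simp only [adIter, ih, mul_add, add_mul, smul_add]
    abel

theorem adIter_mul {u v : R} {x y G : B} (hx : x * G = u • (G * x)) (hy : y * G = v • (G * y))
    (μ : ℕ → R) (r : ℕ) : adIter μ x y r * G = (u ^ r * v) • (G * adIter μ x y r) := by
  induction r with
  | zero => simpa [adIter] using hy
  | succ r ih =>
    simp only [adIter]
    rw [mul_sub, sub_mul, mul_smul_comm, smul_mul_assoc, mul_assoc, ih, mul_assoc _ x, hx,
      mul_smul_comm, ← mul_assoc x, hx, mul_smul_comm, ← mul_assoc _ G x, ih]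
    simp only [smul_mul_assoc, smul_smul, smul_sub, mul_assoc]
    congr 2 <;> ring

/-- Read in `B`, the opposite skew commutator is `Z' (G x) - μ'ᵣ (G x) Z'`. Moving every `G` and
`G'` to the left gives `uʳ Gʳ⁺¹ G' (v Z x - μ'ᵣ w x Z)` up to the scalar `c`, and `v = μ'ᵣ μᵣ w`
makes this a multiple of `x Z - μᵣ Z x`. -/
theorem exists_unop_adIter_eq_smul {u v w : R} {μ μ' : ℕ → R} {x y G G' : B}
    (hxG : x * G = u • (G * x)) (hyG : y * G = v • (G * y)) (hxG' : x * G' = w • (G' * x))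
    (hG : Commute G G') (hμ : ∀ r, μ' r * μ r * w = v) (r : ℕ) :
    ∃ c : R, (adIter μ' (MulOpposite.op (G * x)) (MulOpposite.op (G' * y)) r).unop =
      c • (G ^ r * G' * adIter μ x y r) := by
  induction r with
  | zero => exact ⟨1, by simp [adIter]⟩
  | succ r ih =>
    obtain ⟨c, hc⟩ := ih
    -- This is the coefficient with which `x Zᵣ` appears.
    refine ⟨-(c * μ' r * u ^ r * w), ?_⟩
    have hxGr : x * (G ^ r * G') = (u ^ r * w) • (G ^ r * G' * x) := by
      have h : ∀ r, x * G ^ r = u ^ r • (G ^ r * x) := fun r => by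
        induction r with
        | zero => simp
        | succ r ih =>
          rw [pow_succ, ← mul_assoc, ih, smul_mul_assoc, mul_assoc, hxG, mul_smul_comm, smul_smul,
            mul_assoc, pow_succ]
      rw [← mul_assoc, h, smul_mul_assoc, mul_assoc, hxG', mul_smul_comm, smul_smul, mul_assoc]
    have hGG : G * (G ^ r * G') = G ^ (r + 1) * G' := by rw [← mul_assoc, ← pow_succ']
    have hGG' : (G ^ r * G') * G = G ^ (r + 1) * G' := by
      rw [mul_assoc, ← hG.eq, ← mul_assoc, ← pow_succ]
    set Z := adIter μ x y r with hZ
    have h1 : (G ^ r * G' * Z) * (G * x) = (u ^ r * v) • (G ^ (r + 1) * G' * (Z * x)) := by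
      rw [mul_assoc, ← mul_assoc Z, hZ, adIter_mul hxG hyG, smul_mul_assoc, mul_smul_comm,
        mul_assoc G, ← mul_assoc _ G, hGG']
    have h2 : (G * x) * (G ^ r * G' * Z) = (u ^ r * w) • (G ^ (r + 1) * G' * (x * Z)) := by
      rw [← mul_assoc, mul_assoc G, hxGr, mul_smul_comm, smul_mul_assoc, ← mul_assoc G, hGG,
        mul_assoc _ x]
    simp only [adIter, MulOpposite.unop_sub, MulOpposite.unop_mul, MulOpposite.unop_smul,
      MulOpposite.unop_op, hc]
    rw [← hZ, smul_mul_assoc, mul_smul_comm, h1, h2, ← hμ r]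
    simp only [mul_sub, smul_sub, mul_smul_comm, smul_smul]
    rw [neg_mul, neg_smul, neg_smul, sub_neg_eq_add, neg_add_eq_sub]
    congr 2 <;> ring

/-- The coefficients of the iterated skew commutators for `μᵣ = Qʳ s`. -/
def adCoeff (Q s : R) : ℕ → ℕ → R
  | _, 0 => 1
  | 0, _ + 1 => 0
  | n + 1, m + 1 => adCoeff Q s n (m + 1) - Q ^ n * s * adCoeff Q s n m

theorem adCoeff_zero_right (Q s : R) (n : ℕ) : adCoeff Q s n 0 = 1 := by
  cases n <;> rfl

theorem adCoeff_of_lt (Q s : R) {n m : ℕ} (h : n < m) : adCoeff Q s n m = 0 := by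
  induction n generalizing m with
  | zero =>
    obtain ⟨m, rfl⟩ := Nat.exists_eq_succ_of_ne_zero h.ne'
    rfl
  | succ n ih =>
    obtain ⟨m, rfl⟩ := Nat.exists_eq_succ_of_ne_zero (by omega : m ≠ 0)
    rw [Nat.succ_eq_add_one, adCoeff, ih (by omega), ih (by omega)]
    simp

/-- Left and right multiplication by `x` commute, so the coefficients are those of the polynomial
`∏_{r<n} (1 - Qʳ s z)`. -/
theorem adIter_eq_sum (Q s : R) (x y : B) (n : ℕ) :
    adIter (fun r => Q ^ r * s) x y n =
      ∑ m ∈ Finset.range (n + 1), adCoeff Q s n m • (x ^ (n - m) * y * x ^ m) := by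
  induction n with
  | zero => simp [adIter, adCoeff]
  | succ n ih =>
    -- The sum is lengthened by `m = n + 1`, where the coefficient is zero, to match the range in
    -- degree `n + 1`.
    have h1 : x * adIter (fun r => Q ^ r * s) x y n =
        ∑ m ∈ Finset.range (n + 2), adCoeff Q s n m • (x ^ (n + 1 - m) * y * x ^ m) := by
      rw [Finset.sum_range_succ, adCoeff_of_lt Q s n.lt_succ_self, zero_smul, add_zero, ih,
        Finset.mul_sum]
      refine Finset.sum_congr rfl fun m hm => ?_
      rw [mul_smul_comm, Nat.succ_sub (Nat.lt_succ_iff.1 (Finset.mem_range.1 hm)), pow_succ']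
      simp only [mul_assoc]
    have h2 : adIter (fun r => Q ^ r * s) x y n * x = ∑ m ∈ Finset.range (n + 1),
        adCoeff Q s n m • (x ^ (n + 1 - (m + 1)) * y * x ^ (m + 1)) := by
      rw [ih, Finset.sum_mul]
      refine Finset.sum_congr rfl fun m _ => ?_
      rw [smul_mul_assoc, Nat.add_sub_add_right, pow_succ]
      simp only [mul_assoc]
    rw [adIter, h1, h2, Finset.sum_range_succ', Finset.sum_range_succ' _ (n + 1),
      Finset.smul_sum, add_sub_right_comm, ← Finset.sum_sub_distrib]
    congr 1
    · refine Finset.sum_congr rfl fun m _ => ?_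
      rw [adCoeff, sub_smul, smul_smul]
    · rw [adCoeff_zero_right, adCoeff_zero_right]

end SkewCommutator

/-! ### The quantum Serre relations -/

section QuantumSerre

variable {k : Type*} [Field k]

/-- This is what the Pascal rule for Gaussian binomials becomes once factorials are cleared. -/
theorem qInt_add {q : k⟦X⟧} (hq : q * q⁻¹ = 1) (a b : ℕ) :
    qInt q (a + 1 + b) = q⁻¹ ^ b * qInt q (a + 1) + q ^ (a + 1) * qInt q b := by
  rw [qInt, qInt, qInt, Finset.sum_range_add, Finset.mul_sum, Finset.mul_sum]
  congr 1
  · refine Finset.sum_congr rfl fun s _ => ?_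
    rw [show a + 1 + b - 1 = b + (a + 1 - 1) by omega, pow_add]
    ring
  · refine Finset.sum_congr rfl fun s hs => ?_
    rw [show a + 1 + b - 1 = (b - 1) + (a + 1) by have := Finset.mem_range.1 hs; omega, pow_add,
      mul_add, pow_add, two_mul (a + 1), pow_add]
    have : q ^ (a + 1) * q⁻¹ ^ (a + 1) = 1 := by rw [← mul_pow, hq, one_pow]
    linear_combination (q ^ (a + 1) * q ^ (2 * s) * q⁻¹ ^ (b - 1)) * this

/-- The exponents of `q` in `[n]_q` are symmetric about zero. -/
theorem qInt_inv {q : k⟦X⟧} (hq : q * q⁻¹ = 1) (hq' : q⁻¹⁻¹ = q) (n : ℕ) :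
    qInt q⁻¹ n = qInt q n := by
  rw [qInt, qInt, ← Finset.sum_range_reflect]
  refine Finset.sum_congr rfl fun s hs => ?_
  obtain ⟨t, ht⟩ : ∃ t, n - 1 = s + t :=
    ⟨n - 1 - s, by have := Finset.mem_range.1 hs; omega⟩
  have h1 : q ^ s * q⁻¹ ^ s = 1 := by rw [← mul_pow, hq, one_pow]
  have h2 : q ^ t * q⁻¹ ^ t = 1 := by rw [← mul_pow, hq, one_pow]
  rw [hq', ht, Nat.add_sub_cancel_left, two_mul, two_mul, pow_add, pow_add, pow_add, pow_add]
  linear_combination (q ^ s * q⁻¹ ^ t) * h2 - (q ^ s * q⁻¹ ^ t) * h1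

theorem qBinom_inv {q : k⟦X⟧} (hq : q * q⁻¹ = 1) (hq' : q⁻¹⁻¹ = q) (n m : ℕ) :
    qBinom q⁻¹ n m = qBinom q n m := by
  simp only [qBinom, qFactorial, qInt_inv hq hq']

/-- This is the Gaussian binomial theorem for `∏_{r<m+l} (1 - q²ʳ s z)`. Denominators are cleared,
so the induction needs only `q` to be invertible. The exponent of `q` is `m (m + l - 1)`, written
without a subtraction that could truncate wrongly. -/
theorem adCoeff_mul_qFactorial {q : k⟦X⟧} (hq : q * q⁻¹ = 1) (s : k⟦X⟧) (m l : ℕ) :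
    adCoeff (q ^ 2) s (m + l) m * (qFactorial q m * qFactorial q l) =
      (-1) ^ m * qFactorial q (m + l) * (q ^ (m * l + m * (m - 1)) * s ^ m) := by
  induction hn : m + l generalizing m l with
  | zero =>
    obtain ⟨rfl, rfl⟩ : m = 0 ∧ l = 0 := by omega
    simp [adCoeff, qFactorial]
  | succ n ih =>
    obtain _ | m := m
    · obtain rfl : l = n + 1 := by omega
      simp [adCoeff, qFactorial]
    have hf : ∀ n, qFactorial q (n + 1) = qFactorial q n * qInt q (n + 1) := fun n => by
      simp [qFactorial, Finset.prod_range_succ]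
    have h2 := ih m l (by omega)
    have e2 : (q ^ 2) ^ n * q ^ (m * l + m * (m - 1)) = q ^ l * q ^ ((m + 1) * l + (m + 1) * m) := by
      rw [← pow_mul, ← pow_add, ← pow_add]
      congr 1
      obtain rfl : n = m + l := by omega
      cases m with
      | zero => simp; ring
      | succ m => simp; ring
    -- For `l = 0` the first term of the recursion is zero by degree; otherwise both terms are
    -- covered by the induction hypothesis.
    obtain _ | l := l
    · obtain rfl : n = m := by omega
      rw [adCoeff, adCoeff_of_lt _ _ n.lt_succ_self, hf]
      have h0 : qFactorial q 0 = 1 := by simp [qFactorial]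
      simp only [h0, mul_one, mul_zero, zero_add, pow_zero, one_mul, Nat.add_sub_cancel] at h2 e2 ⊢
      linear_combination (-(q ^ 2) ^ n * s * qInt q (n + 1)) * h2 -
        ((-1) ^ n * qFactorial q n * qInt q (n + 1) * s ^ (n + 1)) * e2
    · have h1 := ih (m + 1) l (by omega)
      have hI : qInt q (n + 1) = q⁻¹ ^ (m + 1) * qInt q (l + 1) + q ^ (l + 1) * qInt q (m + 1) := by
        rw [← qInt_add hq]
        congr 1
        omega
      have hp : q ^ (m + 1) * q⁻¹ ^ (m + 1) = 1 := by rw [← mul_pow, hq, one_pow]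
      have e1 : q ^ ((m + 1) * (l + 1) + (m + 1) * m) =
          q ^ (m + 1) * q ^ ((m + 1) * l + (m + 1) * m) := by
        rw [← pow_add]
        congr 1
        ring
      rw [Nat.add_sub_cancel] at h1 ⊢
      rw [hf l] at h2
      rw [hf m] at h1
      rw [adCoeff, hf n, hf m, hf l, hI]
      rw [e1] at e2 ⊢
      linear_combination qInt q (l + 1) * h1 - ((q ^ 2) ^ n * s * qInt q (m + 1)) * h2 +
        ((-1) ^ (m + 1) * qFactorial q n * qInt q (m + 1) * s ^ (m + 1)) * e2 -
        ((-1) ^ (m + 1) * qFactorial q n * qInt q (l + 1) * s ^ (m + 1) *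
          q ^ ((m + 1) * l + (m + 1) * m)) * hp

theorem constantCoeff_inv_of_eq_one {q : k⟦X⟧} (hq : PowerSeries.constantCoeff q = 1) :
    PowerSeries.constantCoeff q⁻¹ = 1 := by
  rw [PowerSeries.constantCoeff_inv, hq, inv_one]

variable [CharZero k]

theorem constantCoeff_qFactorial_ne_zero {q : k⟦X⟧} (hq : PowerSeries.constantCoeff q = 1)
    (n : ℕ) : PowerSeries.constantCoeff (qFactorial q n) ≠ 0 := by
  rw [qFactorial, map_prod]
  refine Finset.prod_ne_zero_iff.2 fun s _ => ?_
  simp only [qInt, map_sum, map_mul, map_pow, hq, constantCoeff_inv_of_eq_one hq]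
  simpa using Nat.cast_add_one_ne_zero (R := k) s

/-- In degree `n + 1` the binomial theorem yields the power `q^{mn} sᵐ`, which is `σᵐ` for `σ = qⁿ
s`. -/
theorem qBinom_mul_pow {q s σ : k⟦X⟧} (hq : PowerSeries.constantCoeff q = 1) {n m : ℕ}
    (hσ : q ^ n * s = σ) (hm : m ≤ n + 1) :
    (-1) ^ m * qBinom q (n + 1) m * σ ^ m = adCoeff (q ^ 2) s (n + 1) m := by
  obtain ⟨l, hl⟩ := Nat.exists_eq_add_of_le hm
  have hq1 : q * q⁻¹ = 1 := PowerSeries.mul_inv_cancel _ (by simp [hq])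
  have h := adCoeff_mul_qFactorial hq1 s m l
  have hne : PowerSeries.constantCoeff (qFactorial q m * qFactorial q l) ≠ 0 := by
    rw [map_mul]
    exact mul_ne_zero (constantCoeff_qFactorial_ne_zero hq m)
      (constantCoeff_qFactorial_ne_zero hq l)
  have hpow : σ ^ m = q ^ (m * l + m * (m - 1)) * s ^ m := by
    rw [← hσ, mul_pow, ← pow_mul]
    congr 2
    obtain _ | m := m
    · simp
    · obtain rfl : n = m + l := by omega
      rw [Nat.add_sub_cancel]
      ring
  rw [qBinom, hl, Nat.add_sub_cancel_left, hpow]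
  linear_combination (adCoeff (q ^ 2) s (m + l) m) * PowerSeries.mul_inv_cancel _ hne -
    (qFactorial q m * qFactorial q l)⁻¹ * h

variable {B : Type*} [Ring B] [Algebra k⟦X⟧ B]

/-- The quantum Serre polynomial `∑ₘ (-1)ᵐ [n choose m]_q σᵐ xⁿ⁻ᵐ y xᵐ`. -/
def qSerre (q σ : k⟦X⟧) (n : ℕ) (x y : B) : B :=
  ∑ m ∈ Finset.range (n + 1),
    ((-1) ^ m * qBinom q n m * σ ^ m) • (x ^ (n - m) * y * x ^ m)

/-- The reversed quantum Serre polynomial `∑ₘ (-1)ᵐ [n choose m]_q σᵐ xᵐ y xⁿ⁻ᵐ`. -/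
def qSerreRev (q σ : k⟦X⟧) (n : ℕ) (x y : B) : B :=
  ∑ m ∈ Finset.range (n + 1),
    ((-1) ^ m * qBinom q n m * σ ^ m) • (x ^ m * y * x ^ (n - m))

omit [CharZero k] in
theorem unop_qSerre (q σ : k⟦X⟧) (n : ℕ) (x y : Bᵐᵒᵖ) :
    (qSerre q σ n x y).unop = qSerreRev q σ n x.unop y.unop := by
  simp [qSerre, qSerreRev, Finset.unop_sum, mul_assoc]

omit [CharZero k] in
theorem map_qSerre {C : Type*} [Ring C] [Algebra k⟦X⟧ C] (f : B →ₐ[k⟦X⟧] C) (q σ : k⟦X⟧) (n : ℕ)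
    (x y : B) : f (qSerre q σ n x y) = qSerre q σ n (f x) (f y) := by
  simp [qSerre]

omit [CharZero k] in
theorem map_qSerreRev {C : Type*} [Ring C] [Algebra k⟦X⟧ C] (f : B →ₐ[k⟦X⟧] C) (q σ : k⟦X⟧)
    (n : ℕ) (x y : B) : f (qSerreRev q σ n x y) = qSerreRev q σ n (f x) (f y) := by
  simp [qSerreRev]

theorem qSerre_eq_adIter {q s σ : k⟦X⟧} (hq : PowerSeries.constantCoeff q = 1) {n : ℕ}
    (hσ : q ^ n * s = σ) (x y : B) :
    qSerre q σ (n + 1) x y = adIter (fun r => (q ^ 2) ^ r * s) x y (n + 1) := by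
  rw [adIter_eq_sum, qSerre]
  refine Finset.sum_congr rfl fun m hm => ?_
  rw [qBinom_mul_pow hq hσ (by have := Finset.mem_range.1 hm; omega)]

/-- Gaussian binomials are invariant under `q ↔ q⁻¹`, so the same polynomial factors in a second
way, with another `s`. -/
theorem qSerre_eq_adIter' {q s σ : k⟦X⟧} (hq : PowerSeries.constantCoeff q = 1) {n : ℕ}
    (hσ : q⁻¹ ^ n * s = σ) (x y : B) :
    qSerre q σ (n + 1) x y = adIter (fun r => (q⁻¹ ^ 2) ^ r * s) x y (n + 1) := by
  have hne : PowerSeries.constantCoeff q ≠ 0 := by simp [hq]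
  have h1 : q * q⁻¹ = 1 := PowerSeries.mul_inv_cancel _ hne
  have h2 : q⁻¹⁻¹ = q := by
    rw [PowerSeries.inv_eq_iff_mul_eq_one (by rw [constantCoeff_inv_of_eq_one hq]; simp), h1]
  rw [← qSerre_eq_adIter (constantCoeff_inv_of_eq_one hq) hσ]
  simp only [qSerre, qBinom_inv h1 h2]

/-- The quantum Serre polynomial is additive on skew commuting pairs. -/
theorem qSerre_add {q s s' t σ : k⟦X⟧} (hq : PowerSeries.constantCoeff q = 1) {n : ℕ}
    (hσ : q ^ n * s = σ) (hσ' : q⁻¹ ^ n * s' = σ) (ht : s' * t = 1) {a a' b b' : B}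
    (hba : b * a = q ^ 2 • (a * b)) (hba' : b * a' = s • (a' * b))
    (hb'a : b' * a = t • (a * b')) :
    qSerre q σ (n + 1) (a + b) (a' + b') =
      qSerre q σ (n + 1) a a' + qSerre q σ (n + 1) b b' := by
  have h1 : q * q⁻¹ = 1 := PowerSeries.mul_inv_cancel _ (by simp [hq])
  have hab : a * b = q⁻¹ ^ 2 • (b * a) := by
    rw [hba, smul_smul, ← mul_pow, mul_comm, h1, one_pow, one_smul]
  have hab' : a * b' = s' • (b' * a) := by rw [hb'a, smul_smul, ht, one_smul]
  have hadd : qSerre q σ (n + 1) (a + b) (a' + b') =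
      qSerre q σ (n + 1) (a + b) a' + qSerre q σ (n + 1) (a + b) b' := by
    simp only [qSerre_eq_adIter hq hσ, adIter_add_right]
  -- Against `a'`, the form with `q` removes `b`; against `b'`, the form with `q⁻¹` removes `a`.
  rw [hadd, qSerre_eq_adIter hq hσ, adIter_add_left hba hba', ← qSerre_eq_adIter hq hσ,
    add_comm a b, qSerre_eq_adIter' hq hσ' (b + a), adIter_add_left hab hab',
    ← qSerre_eq_adIter' hq hσ']

omit [CharZero k] in
theorem qSerre_mul {q σ : k⟦X⟧} {n : ℕ} {x y G G' : B} (hx : Commute G x) (hy : Commute G y)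
    (hx' : Commute G' x) (hG : Commute G G') :
    qSerre q σ n (G * x) (G' * y) = G ^ n * G' * qSerre q σ n x y := by
  rw [qSerre, qSerre, Finset.mul_sum]
  refine Finset.sum_congr rfl fun m hm => ?_
  have hmn : n = (n - m) + m := by have := Finset.mem_range.1 hm; omega
  have e1 : (x ^ (n - m)) * G' = G' * x ^ (n - m) := (hx'.pow_right _).eq.symm
  have e2 : (x ^ (n - m)) * G ^ m = G ^ m * x ^ (n - m) := (hx.pow_pow _ _).eq.symm
  have e3 : y * G ^ m = G ^ m * y := (hy.pow_left _).eq.symm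
  have e4 : G' * G ^ m = G ^ m * G' := (hG.pow_left _).eq.symm
  rw [mul_smul_comm, hx.mul_pow, hx.mul_pow]
  congr 1
  calc G ^ (n - m) * x ^ (n - m) * (G' * y) * (G ^ m * x ^ m)
      = G ^ (n - m) * (x ^ (n - m) * G') * (y * G ^ m) * x ^ m := by simp only [mul_assoc]
    _ = G ^ (n - m) * G' * (x ^ (n - m) * G ^ m) * y * x ^ m := by
        rw [e1, e3]; simp only [mul_assoc]
    _ = G ^ (n - m) * (G' * G ^ m) * x ^ (n - m) * y * x ^ m := by
        rw [e2]; simp only [mul_assoc]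
    _ = G ^ n * G' * (x ^ (n - m) * y * x ^ m) := by
        rw [e4, ← mul_assoc (G ^ (n - m)), ← pow_add, ← hmn]; simp only [mul_assoc]

/-- The reversed polynomial is the Serre polynomial of the opposite algebra. Its `q⁻¹`-form there is
a multiple of `Gⁿ⁺¹ G'` times the `q`-form of the original one. -/
theorem qSerreRev_eq_zero {q s s' u v w σ : k⟦X⟧} (hq : PowerSeries.constantCoeff q = 1) {n : ℕ}
    (hσ : q ^ n * s = σ) (hσ' : q⁻¹ ^ n * s' = σ) (hv : s' * s * w = v) {x y G G' : B}
    (hxG : x * G = u • (G * x)) (hyG : y * G = v • (G * y)) (hxG' : x * G' = w • (G' * x))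
    (hG : Commute G G') (h : qSerre q σ (n + 1) x y = 0) :
    qSerreRev q σ (n + 1) (G * x) (G' * y) = 0 := by
  have h1 : q * q⁻¹ = 1 := PowerSeries.mul_inv_cancel _ (by simp [hq])
  obtain ⟨c, hc⟩ := exists_unop_adIter_eq_smul (μ := fun r => (q ^ 2) ^ r * s)
    (μ' := fun r => (q⁻¹ ^ 2) ^ r * s') hxG hyG hxG' hG (fun r => by
      have h2 : (q ^ 2) ^ r * (q⁻¹ ^ 2) ^ r = 1 := by
        rw [← mul_pow, ← mul_pow, h1, one_pow, one_pow]
      linear_combination (s' * s * w) * h2 + hv) (n + 1)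
  rw [← qSerre_eq_adIter hq hσ, h, mul_zero, smul_zero, ← qSerre_eq_adIter' hq hσ',
    unop_qSerre] at hc
  exact hc

end QuantumSerre

/-! ### Weights for the adjoint action -/

section Weight

variable {R : Type*} [CommRing R] {B : Type*} [Ring B] [Algebra R B]

/-- `T x - x T = c x`. -/
def HasWeight (T x : B) (c : R) : Prop := T * x - x * T = c • x

namespace HasWeight

variable {T T' x y : B} {c c' : R}

theorem of_commute (h : Commute T x) : HasWeight T x (0 : R) := by
  rw [HasWeight, h.eq, sub_self, zero_smul]

theorem add_left (h : HasWeight T x c) (h' : HasWeight T' x c') :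
    HasWeight (T + T') x (c + c') := by
  rw [HasWeight] at *
  rw [add_smul, ← h, ← h', add_mul, mul_add]
  abel

theorem neg_left (h : HasWeight T x c) : HasWeight (-T) x (-c) := by
  rw [HasWeight] at *
  rw [neg_smul, ← h, neg_mul, mul_neg]
  abel

theorem neg_right (h : HasWeight T x c) : HasWeight T (-x) c := by
  rw [HasWeight] at *
  rw [smul_neg, ← h, neg_mul, mul_neg]
  abel

theorem add_right (h : HasWeight T x c) (h' : HasWeight T y c) : HasWeight T (x + y) c := by
  rw [HasWeight] at *
  rw [smul_add, ← h, ← h', add_mul, mul_add]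
  abel

theorem mul (h : HasWeight T x c) (h' : HasWeight T y c') : HasWeight T (x * y) (c + c') := by
  rw [HasWeight] at *
  rw [add_smul, ← smul_mul_assoc, ← h, ← mul_smul_comm, ← h', sub_mul, mul_sub]
  simp only [mul_assoc]
  abel

/-- Reversing products changes the sign of a commutator, and `T ↦ -T` restores it; this is why `S(T)
= -T` preserves weights. -/
theorem op_neg (h : HasWeight T x c) : HasWeight (-MulOpposite.op T) (MulOpposite.op x) c := by
  rw [HasWeight] at *
  rw [← MulOpposite.op_smul, ← h, neg_mul, mul_neg, ← MulOpposite.op_mul, ← MulOpposite.op_mul,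
    MulOpposite.op_sub]
  abel

theorem map {C : Type*} [Ring C] [Algebra R C] (φ : B →ₐ[R] C) (h : HasWeight T x c) :
    HasWeight (φ T) (φ x) c := by
  rw [HasWeight] at *
  rw [← map_mul, ← map_mul, ← map_sub, h, map_smul]

end HasWeight

end Weight

section HasWeightExp

variable {k : Type*} [Field k] [CharZero k] {B : Type*} [Ring B] [Algebra k⟦X⟧ B]
  [IsAdicComplete (hIdeal k) B] {T x : B} {c : k⟦X⟧}

theorem HasWeight.hExp_mul (h : HasWeight T x c) :
    hExp k T * x = hExp k c • (x * hExp k T) :=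
  hExp_mul_of_commutator h

theorem HasWeight.mul_hExp (h : HasWeight T x c) :
    x * hExp k T = hExp k (-c) • (hExp k T * x) := by
  rw [h.hExp_mul, smul_smul, hExp_neg_mul_hExp, one_smul]

end HasWeightExp

/-! ### Scalars -/

section Scalars

variable {k : Type*} [Field k]

theorem constantCoeff_hExp (x : k⟦X⟧) : PowerSeries.constantCoeff (hExp k x) = 1 := by
  rw [hExp_eq_one_add]
  simp

theorem op_hExp {B : Type*} [Ring B] [Algebra k⟦X⟧ B] [IsAdicComplete (hIdeal k) B]
    (x : B) : MulOpposite.op (hExp k x) = hExp k (MulOpposite.op x) := by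
  refine (map_hSum (MulOpposite.opLinearEquiv k⟦X⟧ : B ≃ₗ[k⟦X⟧] Bᵐᵒᵖ).toLinearMap _).trans ?_
  simp [hExp]

theorem op_hExpDiff {B : Type*} [Ring B] [Algebra k⟦X⟧ B] [IsAdicComplete (hIdeal k) B]
    (x y : B) : MulOpposite.op (hExpDiff k x y) =
      hExpDiff k (MulOpposite.op x) (MulOpposite.op y) := by
  refine (map_hSum (MulOpposite.opLinearEquiv k⟦X⟧ : B ≃ₗ[k⟦X⟧] Bᵐᵒᵖ).toLinearMap _).trans ?_
  simp [hExpDiff]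

theorem op_hExpQuot {B : Type*} [Ring B] [Algebra k⟦X⟧ B] [IsAdicComplete (hIdeal k) B]
    (c : k⟦X⟧) (x y : B) : MulOpposite.op (hExpQuot k c x y) =
      hExpQuot k c (MulOpposite.op x) (MulOpposite.op y) := by
  rw [hExpQuot, MulOpposite.op_smul, op_hExpDiff, hExpQuot]

variable [CharZero k]

theorem hExp_inv (x : k⟦X⟧) : (hExp k x)⁻¹ = hExp k (-x) := by
  rw [PowerSeries.inv_eq_iff_mul_eq_one (by simp [constantCoeff_hExp]), hExp_neg_mul_hExp]

theorem hExp_mul (x y : k⟦X⟧) : hExp k x * hExp k y = hExp k (x + y) :=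
  (hExp_add (Commute.all x y)).symm

theorem hExp_pow (x : k⟦X⟧) (n : ℕ) : hExp k x ^ n = hExp k (n * x) := by
  induction n with
  | zero => simp
  | succ n ih => rw [pow_succ, ih, hExp_mul]; congr 1; push_cast; ring

variable {I : Type*} {A : Matrix I I ℤ} {d : I → ℕ} {P : Matrix I I k⟦X⟧}

omit [CharZero k] in
theorem constantCoeff_qi (i : I) : PowerSeries.constantCoeff (qi k d i) = 1 :=
  constantCoeff_hExp _

omit [CharZero k] in
theorem two_mul_C_inv_two [NeZero (2 : k)] : (2 : k⟦X⟧) * PowerSeries.C (2⁻¹ : k) = 1 := by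
  rw [← map_ofNat (PowerSeries.C (R := k)) 2, ← map_mul, mul_inv_cancel₀ two_ne_zero, map_one]

theorem two_ne_zero_powerSeries : (2 : k⟦X⟧) ≠ 0 :=
  left_ne_zero_of_mul_eq_one (two_mul_C_inv_two (k := k))

theorem qi_sq (hA : IsGCM A) (hP : IsCartanType A d P) (i : I) :
    qi k d i ^ 2 = hExp k (P i i) := by
  rw [qi, hExp_pow]
  congr 1
  have h := hP i i
  rw [hA.diag] at h
  refine mul_left_cancel₀ (two_ne_zero_powerSeries (k := k)) ?_
  push_cast at h ⊢
  linear_combination -h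

variable (P) in
/-- `(qᵢⱼ / qⱼᵢ)^{1/2}` -/
def serreParam (i j : I) : k⟦X⟧ := qHalf P i j * (qHalf P j i)⁻¹

/-- Cartan type gives `pᵢⱼ - dᵢaᵢⱼ = (pᵢⱼ - pⱼᵢ)/2 = dᵢaᵢⱼ - pⱼᵢ`. The first equality is used here,
the second in `qi_inv_pow_mul`. -/
theorem qi_pow_mul (hP : IsCartanType A d P) {i j : I} {n : ℕ} (hn : (n : ℤ) = -A i j) :
    qi k d i ^ n * hExp k (P i j) = serreParam P i j := by
  rw [qi, hExp_pow, serreParam, qHalf, qHalf, hExp_inv, hExp_mul, hExp_mul]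
  congr 1
  have hn' : (n : k⟦X⟧) = -(A i j : k⟦X⟧) := by exact_mod_cast congrArg (Int.cast (R := k⟦X⟧)) hn
  refine mul_left_cancel₀ (two_ne_zero_powerSeries (k := k)) ?_
  rw [hn']
  linear_combination hP i j - (P i j - P j i) * two_mul_C_inv_two (k := k)

theorem qi_inv_pow_mul (hP : IsCartanType A d P) {i j : I} {n : ℕ} (hn : (n : ℤ) = -A i j) :
    (qi k d i)⁻¹ ^ n * hExp k (-P j i) = serreParam P i j := by
  rw [← qi_pow_mul hP hn, qi, hExp_inv, hExp_pow, hExp_pow, hExp_mul, hExp_mul]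
  congr 1
  have hn' : (n : k⟦X⟧) = -(A i j : k⟦X⟧) := by exact_mod_cast congrArg (Int.cast (R := k⟦X⟧)) hn
  rw [hn']
  linear_combination -(hP i j)

omit [CharZero k] in
theorem sum_serreCoeff_eq_qSerre {B : Type*} [Ring B] [Algebra k⟦X⟧ B] (i j : I) (x y : B) :
    ∑ m ∈ Finset.range ((1 - A i j).toNat + 1), serreCoeff A d P i j m •
        (x ^ ((1 - A i j).toNat - m) * y * x ^ m) =
      qSerre (qi k d i) (serreParam P i j) (1 - A i j).toNat x y := by
  simp only [qSerre, serreCoeff, serreParam, mul_pow, mul_assoc]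

omit [CharZero k] in
theorem sum_serreCoeff_eq_qSerreRev {B : Type*} [Ring B] [Algebra k⟦X⟧ B] (i j : I) (x y : B) :
    ∑ m ∈ Finset.range ((1 - A i j).toNat + 1), serreCoeff A d P i j m •
        (x ^ m * y * x ^ ((1 - A i j).toNat - m)) =
      qSerreRev (qi k d i) (serreParam P i j) (1 - A i j).toNat x y := by
  simp only [qSerreRev, serreCoeff, serreParam, mul_pow, mul_assoc]

end Scalars

/-! ### Systems of elements satisfying the defining relations -/

section RelSystem

variable {k : Type*} [Field k] {I : Type*} {h : Type*} [AddCommGroup h] [Module k⟦X⟧ h]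

/-- Elements `t(T)`, `eᵢ`, `fᵢ` of a complete algebra satisfying the defining relations. -/
structure RelSystem (A : Matrix I I ℤ) (d : I → ℕ) {P : Matrix I I k⟦X⟧} (ρ : Realization P h)
    {B : Type*} [Ring B] [Algebra k⟦X⟧ B] [IsAdicComplete (hIdeal k) B]
    (t : h →ₗ[k⟦X⟧] B) (e f : I → B) : Prop where
  TE (T : h) (j : I) : HasWeight (t T) (e j) (ρ.α j T)
  TF (T : h) (j : I) : HasWeight (t T) (f j) (-ρ.α j T)
  TT (T T' : h) : Commute (t T) (t T')
  EF_same (i : I) :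
    e i * f i - f i * e i = hExpQuot k (d i : k⟦X⟧) (t (ρ.Tp i)) (t (ρ.Tm i))
  EF_ne {i j : I} (hij : i ≠ j) : e i * f j - f j * e i = 0
  serreE {i j : I} (hij : i ≠ j) :
    qSerre (qi k d i) (serreParam P i j) (1 - A i j).toNat (e i) (e j) = 0
  serreF {i j : I} (hij : i ≠ j) :
    qSerreRev (qi k d i) (serreParam P i j) (1 - A i j).toNat (f i) (f j) = 0

variable {A : Matrix I I ℤ} {d : I → ℕ} {P : Matrix I I k⟦X⟧} {ρ : Realization P h}

/-- This system, taken in `𝕜[[ħ]]`, defines the counit. -/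
theorem RelSystem.zero {B : Type*} [Ring B] [Algebra k⟦X⟧ B] [IsAdicComplete (hIdeal k) B] :
    RelSystem A d ρ (0 : h →ₗ[k⟦X⟧] B) 0 0 where
  TE T j := by simp [HasWeight]
  TF T j := by simp [HasWeight]
  TT T T' := by simp
  EF_same i := by simp [hExpQuot, hExpDiff_eq]
  EF_ne hij := by simp
  serreE hij := by simp [qSerre]
  serreF hij := by simp [qSerreRev]

theorem IsGCM.exists_toNat_eq (hA : IsGCM A) {i j : I} (hij : i ≠ j) :
    ∃ n : ℕ, (1 - A i j).toNat = n + 1 ∧ (n : ℤ) = -A i j := by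
  have := hA.nonpos hij
  exact ⟨(-A i j).toNat, by omega, by omega⟩

/-! ### The defining relations for the coproduct -/

section Tensor

variable [CharZero k] {H : Type*} [Ring H] [Algebra k⟦X⟧ H] [IsAdicComplete (hIdeal k) H]
  {C : Type*} [Ring C] [Algebra k⟦X⟧ C] [IsAdicComplete (hIdeal k) C]
  {t : h →ₗ[k⟦X⟧] H} {e f : I → H}

namespace RelSystem

variable (S : RelSystem A d ρ t e f) {φ ψ : H →ₐ[k⟦X⟧] C} (hc : ∀ x y, Commute (φ x) (ψ y))
include S hc

-- The mixed products of `Kᵢ ⊗ Eᵢ` with `Fⱼ ⊗ Mⱼ` agree in both orders, because `αⱼ(Tᵢ⁺) = pᵢⱼ =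
-- αᵢ(Tⱼ⁻)` makes the two exchange factors equal.
omit [IsAdicComplete (hIdeal k) C] in
theorem tensor_commutator (i j : I) :
    (φ (e i) + φ (hExp k (t (ρ.Tp i))) * ψ (e i)) *
        (φ (f j) * ψ (hExp k (-t (ρ.Tm j))) + ψ (f j)) -
      (φ (f j) * ψ (hExp k (-t (ρ.Tm j))) + ψ (f j)) *
        (φ (e i) + φ (hExp k (t (ρ.Tp i))) * ψ (e i)) =
    φ (e i * f j - f j * e i) * ψ (hExp k (-t (ρ.Tm j))) +
      φ (hExp k (t (ρ.Tp i))) * ψ (e i * f j - f j * e i) := by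
  have h1 := congrArg φ (S.TF (ρ.Tp i) j).hExp_mul
  have h2 := congrArg ψ (S.TE (ρ.Tm j) i).neg_left.hExp_mul
  rw [ρ.α_Tp, map_mul, map_smul, map_mul] at h1
  rw [ρ.α_Tm, map_mul, map_smul, map_mul] at h2
  set K := hExp k (t (ρ.Tp i))
  set M := hExp k (-t (ρ.Tm j))
  have e1 : φ K * ψ (e i) * (φ (f j) * ψ M) =
      hExp k (-P i j) • (φ (f j) * φ K * (ψ (e i) * ψ M)) := by
    rw [(hc (f j) (e i)).symm.mul_mul_mul_comm, h1, smul_mul_assoc]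
  have e2 : φ (f j) * ψ M * (φ K * ψ (e i)) =
      hExp k (-P i j) • (φ (f j) * φ K * (ψ (e i) * ψ M)) := by
    rw [(hc K M).symm.mul_mul_mul_comm, h2, mul_smul_comm]
  have e3 : φ (f j) * ψ M * φ (e i) = φ (f j) * φ (e i) * ψ M := by
    rw [mul_assoc, ← (hc (e i) M).eq, mul_assoc]
  have e4 : ψ (f j) * (φ K * ψ (e i)) = φ K * (ψ (f j) * ψ (e i)) := by
    rw [← mul_assoc, ← (hc K (f j)).eq, mul_assoc]
  simp only [mul_add, add_mul, map_sub, map_mul, e1, e2, e3, e4, (hc (e i) (f j)).eq]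
  simp only [sub_mul, mul_sub, mul_assoc]
  abel

/-- The maps `φ`, `ψ` stand for `x ↦ x ⊗ 1` and `x ↦ 1 ⊗ x`; only the commutation of their images
matters. -/
theorem tensor (hA : IsGCM A) (hP : IsCartanType A d P) :
    RelSystem A d ρ (φ.toLinearMap ∘ₗ t + ψ.toLinearMap ∘ₗ t)
      (fun i => φ (e i) + φ (hExp k (t (ρ.Tp i))) * ψ (e i))
      (fun i => φ (f i) * ψ (hExp k (-t (ρ.Tm i))) + ψ (f i)) where
  TE T j := by
    have h1 : HasWeight (φ (t T)) (φ (e j)) (ρ.α j T) := (S.TE T j).map φ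
    have h2 : HasWeight (ψ (t T)) (φ (e j)) (0 : k⟦X⟧) := .of_commute (hc _ _).symm
    have h3 : HasWeight (φ (t T)) (φ (hExp k (t (ρ.Tp j)))) (0 : k⟦X⟧) :=
      .of_commute ((S.TT _ _).hExp_right.map φ)
    have h4 : HasWeight (ψ (t T)) (φ (hExp k (t (ρ.Tp j)))) (0 : k⟦X⟧) :=
      .of_commute (hc _ _).symm
    have h5 : HasWeight (φ (t T)) (ψ (e j)) (0 : k⟦X⟧) := .of_commute (hc _ _)
    have h6 : HasWeight (ψ (t T)) (ψ (e j)) (ρ.α j T) := (S.TE T j).map ψ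
    have := (h1.add_left h2).add_right (y := φ (hExp k (t (ρ.Tp j))) * ψ (e j))
      (by simpa using (h3.add_left h4).mul (h5.add_left h6))
    simpa using this
  TF T j := by
    have h1 : HasWeight (φ (t T)) (φ (f j)) (-ρ.α j T) := (S.TF T j).map φ
    have h2 : HasWeight (ψ (t T)) (φ (f j)) (0 : k⟦X⟧) := .of_commute (hc _ _).symm
    have h3 : HasWeight (φ (t T)) (ψ (hExp k (-t (ρ.Tm j)))) (0 : k⟦X⟧) := .of_commute (hc _ _)
    have h4 : HasWeight (ψ (t T)) (ψ (hExp k (-t (ρ.Tm j)))) (0 : k⟦X⟧) :=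
      .of_commute ((S.TT _ _).neg_right.hExp_right.map ψ)
    have h5 : HasWeight (φ (t T)) (ψ (f j)) (0 : k⟦X⟧) := .of_commute (hc _ _)
    have h6 : HasWeight (ψ (t T)) (ψ (f j)) (-ρ.α j T) := (S.TF T j).map ψ
    have := ((h1.add_left h2).mul (h3.add_left h4)).add_right (y := ψ (f j))
      (by simpa using h5.add_left h6)
    simpa using this
  TT T T' :=
    .add_left (.add_right ((S.TT _ _).map φ) (hc _ _))
      (.add_right (hc _ _).symm ((S.TT _ _).map ψ))
  EF_same i := by
    rw [S.tensor_commutator hc, S.EF_same]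
    simp only [LinearMap.add_apply, LinearMap.comp_apply, AlgHom.toLinearMap_apply]
    rw [hExpQuot_add_add _ (hc _ _) (hc _ _) (hc _ _), map_hExpQuot, map_hExpQuot, map_hExp,
      map_hExp, map_neg]
  EF_ne {i j} hij := by
    rw [S.tensor_commutator hc, S.EF_ne hij]
    simp
  serreE {i j} hij := by
    obtain ⟨n, hn, hnA⟩ := hA.exists_toNat_eq hij
    have hS := S.serreE hij
    rw [hn] at hS ⊢
    have key : ∀ i j, φ (hExp k (t (ρ.Tp i))) * ψ (e i) * φ (e j) =
        hExp k (P i j) • (φ (e j) * (φ (hExp k (t (ρ.Tp i))) * ψ (e i))) := by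
      intro i j
      have h1 := congrArg φ (S.TE (ρ.Tp i) j).hExp_mul
      rw [ρ.α_Tp, map_mul, map_smul, map_mul] at h1
      rw [mul_assoc, ← (hc _ _).eq, ← mul_assoc, h1, smul_mul_assoc, mul_assoc]
    -- Here `q² = e^{ħpᵢᵢ}`, `s = e^{ħpᵢⱼ}`, `s' = e^{-ħpⱼᵢ}` and `t = e^{ħpⱼᵢ}`. In the second
    -- summand the grouplike factors come out in front.
    rw [qSerre_add (constantCoeff_qi i) (qi_pow_mul hP hnA) (qi_inv_pow_mul hP hnA)
      (hExp_neg_mul_hExp _) (by rw [qi_sq hA hP]; exact key i i) (key i j) (key j i),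
      ← map_qSerre, hS, qSerre_mul (hc _ _) (hc _ _) (hc _ _)
        ((S.TT _ _).hExp_left.hExp_right.map φ), ← map_qSerre, hS]
    simp
  serreF {i j} hij := by
    obtain ⟨n, hn, hnA⟩ := hA.exists_toNat_eq hij
    have hS := S.serreF hij
    rw [hn] at hS ⊢
    have key : ∀ i j, φ (f j) * ψ (hExp k (-t (ρ.Tm j))) * ψ (f i) =
        hExp k (P i j) • (ψ (f i) * (φ (f j) * ψ (hExp k (-t (ρ.Tm j))))) := by
      intro i j
      have h1 := congrArg ψ (S.TF (ρ.Tm j) i).neg_left.hExp_mul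
      rw [ρ.α_Tm, map_mul, map_smul, map_mul, neg_neg] at h1
      rw [mul_assoc, h1, mul_smul_comm, ← mul_assoc, (hc _ _).eq, mul_assoc]
    -- In the opposite algebra the relation for `F` takes the form of the one for `E`, with the same
    -- exchange factors.
    have hop : ∀ x y : C, qSerreRev (qi k d i) (serreParam P i j) (n + 1) x y =
        (qSerre (qi k d i) (serreParam P i j) (n + 1) (MulOpposite.op x)
          (MulOpposite.op y)).unop := fun x y => by rw [unop_qSerre]; rfl
    have key' : ∀ i j, MulOpposite.op (ψ (f i)) *
        MulOpposite.op (φ (f j) * ψ (hExp k (-t (ρ.Tm j)))) = hExp k (P i j) •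
          (MulOpposite.op (φ (f j) * ψ (hExp k (-t (ρ.Tm j)))) * MulOpposite.op (ψ (f i))) := by
      intro i j
      rw [← MulOpposite.op_mul, ← MulOpposite.op_mul, ← MulOpposite.op_smul, key]
    have hco : ∀ x y, Commute (MulOpposite.op (ψ y)) (MulOpposite.op (φ x)) :=
      fun x y => (hc x y).symm.op
    rw [hop, MulOpposite.op_add, MulOpposite.op_add,
      qSerre_add (constantCoeff_qi i) (qi_pow_mul hP hnA) (qi_inv_pow_mul hP hnA)
      (hExp_neg_mul_hExp _) (by rw [qi_sq hA hP]; exact key' i i) (key' i j) (key' j i),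
      MulOpposite.unop_add, MulOpposite.op_mul, MulOpposite.op_mul,
      qSerre_mul (hco _ _) (hco _ _) (hco _ _)
        ((S.TT _ _).neg_left.neg_right.hExp_left.hExp_right.map ψ).op,
      MulOpposite.unop_mul, ← hop, ← hop, ← map_qSerreRev, ← map_qSerreRev, hS]
    simp

end RelSystem

end Tensor

/-! ### The defining relations for the antipode -/

section Antipode

variable [CharZero k] {H : Type*} [Ring H] [Algebra k⟦X⟧ H] [IsAdicComplete (hIdeal k) H]
  {t : h →ₗ[k⟦X⟧] H} {e f : I → H}

namespace RelSystem

variable (S : RelSystem A d ρ t e f)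
include S

/-- Moving the exponentials outwards past `Fⱼ` and `Eᵢ` produces mutually inverse scalars, again by
`αⱼ(Tᵢ⁺) = αᵢ(Tⱼ⁻)`. -/
theorem antipode_commutator (i j : I) :
    MulOpposite.op (-(hExp k (-t (ρ.Tp i)) * e i)) * MulOpposite.op (-(f j * hExp k (t (ρ.Tm j)))) -
      MulOpposite.op (-(f j * hExp k (t (ρ.Tm j)))) *
        MulOpposite.op (-(hExp k (-t (ρ.Tp i)) * e i)) =
    MulOpposite.op (-(hExp k (-t (ρ.Tp i)) * (e i * f j - f j * e i) * hExp k (t (ρ.Tm j)))) := by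
  have h1 := (S.TF (ρ.Tp i) j).neg_left.mul_hExp
  have h2 := (S.TE (ρ.Tm j) i).hExp_mul
  rw [ρ.α_Tp, neg_neg] at h1
  rw [ρ.α_Tm] at h2
  have hKL : hExp k (t (ρ.Tm j)) * hExp k (-t (ρ.Tp i)) =
      hExp k (-t (ρ.Tp i)) * hExp k (t (ρ.Tm j)) :=
    (S.TT _ _).neg_right.hExp_left.hExp_right
  set K := hExp k (-t (ρ.Tp i))
  set L := hExp k (t (ρ.Tm j))
  have e1 : f j * L * (K * e i) = K * (f j * e i) * L := by
    rw [mul_assoc, ← mul_assoc L, hKL, mul_assoc K, h2, mul_smul_comm, mul_smul_comm, ← mul_assoc,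
      h1, smul_mul_assoc, smul_smul, hExp_mul_hExp_neg, one_smul]
    simp only [mul_assoc]
  rw [← MulOpposite.op_mul, ← MulOpposite.op_mul, ← MulOpposite.op_sub, neg_mul_neg, neg_mul_neg,
    e1]
  congr 1
  simp only [mul_sub, sub_mul, mul_assoc]
  abel

theorem antipode (hA : IsGCM A) (hP : IsCartanType A d P) :
    RelSystem A d ρ (-((MulOpposite.opLinearEquiv k⟦X⟧).toLinearMap ∘ₗ t))
      (fun i => MulOpposite.op (-(hExp k (-t (ρ.Tp i)) * e i)))
      (fun i => MulOpposite.op (-(f i * hExp k (t (ρ.Tm i))))) where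
  TE T j := by
    have h1 : HasWeight (t T) (hExp k (-t (ρ.Tp j))) (0 : k⟦X⟧) :=
      .of_commute (S.TT _ _).neg_right.hExp_right
    simpa using ((h1.mul (S.TE T j)).neg_right).op_neg
  TF T j := by
    have h1 : HasWeight (t T) (hExp k (t (ρ.Tm j))) (0 : k⟦X⟧) :=
      .of_commute (S.TT _ _).hExp_right
    simpa using (((S.TF T j).mul h1).neg_right).op_neg
  TT T T' := (S.TT T T').op.neg_left.neg_right
  EF_same i := by
    rw [S.antipode_commutator, S.EF_same, ← hExpQuot_neg_neg, op_hExpQuot]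
    rfl
  EF_ne {i j} hij := by
    rw [S.antipode_commutator, S.EF_ne hij]
    simp
  serreE {i j} hij := by
    obtain ⟨n, hn, hnA⟩ := hA.exists_toNat_eq hij
    have hS := S.serreE hij
    rw [hn] at hS ⊢
    have key : ∀ i j, e j * -hExp k (-t (ρ.Tp i)) =
        hExp k (P i j) • (-hExp k (-t (ρ.Tp i)) * e j) := by
      intro i j
      have h1 := (S.TE (ρ.Tp i) j).neg_left.mul_hExp
      rw [ρ.α_Tp, neg_neg] at h1
      rw [mul_neg, h1, neg_mul, smul_neg]
    have hG : Commute (-hExp k (-t (ρ.Tp i))) (-hExp k (-t (ρ.Tp j))) :=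
      (S.TT _ _).neg_left.neg_right.hExp_left.hExp_right.neg_left.neg_right
    -- The condition `s' s w = v` reads `e^{-ħpⱼᵢ} e^{ħpᵢⱼ} e^{ħpⱼᵢ} = e^{ħpᵢⱼ}`.
    have := qSerreRev_eq_zero (constantCoeff_qi i) (qi_pow_mul hP hnA) (qi_inv_pow_mul hP hnA)
      (by rw [mul_right_comm, hExp_neg_mul_hExp, one_mul]) (key i i) (key i j) (key j i) hG hS
    refine MulOpposite.unop_injective ?_
    rw [unop_qSerre]
    simpa using this
  serreF {i j} hij := by
    obtain ⟨n, hn, hnA⟩ := hA.exists_toNat_eq hij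
    have hS := S.serreF hij
    rw [hn] at hS ⊢
    have hS' : qSerre (qi k d i) (serreParam P i j) (n + 1) (MulOpposite.op (f i))
        (MulOpposite.op (f j)) = 0 := by
      refine MulOpposite.unop_injective ?_
      rw [unop_qSerre]
      exact hS
    have key : ∀ i j, MulOpposite.op (f j) * MulOpposite.op (-hExp k (t (ρ.Tm i))) =
        hExp k (-P j i) • (MulOpposite.op (-hExp k (t (ρ.Tm i))) * MulOpposite.op (f j)) := by
      intro i j
      have h1 := (S.TF (ρ.Tm i) j).hExp_mul
      rw [ρ.α_Tm] at h1
      rw [← MulOpposite.op_mul, ← MulOpposite.op_mul, neg_mul, h1, mul_neg, ← smul_neg,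
        MulOpposite.op_smul]
    have hG : Commute (MulOpposite.op (-hExp k (t (ρ.Tm i))))
        (MulOpposite.op (-hExp k (t (ρ.Tm j)))) :=
      (S.TT _ _).hExp_left.hExp_right.neg_left.neg_right.op
    -- The lemma is applied inside `Hᵐᵒᵖ`, with `w = e^{-ħpᵢⱼ}` and `v = e^{-ħpⱼᵢ}`.
    have := qSerreRev_eq_zero (constantCoeff_qi i) (qi_pow_mul hP hnA) (qi_inv_pow_mul hP hnA)
      (by rw [mul_assoc, hExp_mul_hExp_neg, mul_one]) (key i i) (key i j) (key j i) hG hS'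
    simpa [← MulOpposite.op_mul] using this

end RelSystem

end Antipode

end RelSystem

/-! ### The universal property -/

section UniversalProperty

variable {k : Type*} [Field k] {I : Type*} {h : Type*} [AddCommGroup h] [Module k⟦X⟧ h]

section Free

variable {B : Type*} [Ring B] [Algebra k⟦X⟧ B] [IsAdicComplete (hIdeal k) B]

/-- The homomorphism from the free complete algebra with prescribed values on generators. -/
def freeLift (t : h →ₗ[k⟦X⟧] B) (e f : I → B) : FreeAlg k I h →ₐ[k⟦X⟧] B :=
  Completion.extendAlgHom (TensorAlgebra.lift k⟦X⟧
    (t.coprod ((Finsupp.linearCombination k⟦X⟧ e).coprod (Finsupp.linearCombination k⟦X⟧ f))))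

variable (t : h →ₗ[k⟦X⟧] B) (e f : I → B)

@[simp]
theorem freeLift_freeT (T : h) : freeLift t e f (freeT T) = t T := by
  simp [freeLift, freeT]

@[simp]
theorem freeLift_freeE (i : I) : freeLift t e f (freeE i) = e i := by
  simp [freeLift, freeE]

@[simp]
theorem freeLift_freeF (i : I) : freeLift t e f (freeF i) = f i := by
  simp [freeLift, freeF]

end Free

variable (A : Matrix I I ℤ) (d : I → ℕ) {P : Matrix I I k⟦X⟧} (ρ : Realization P h)

theorem toUPh_eq_of_rel {x y : FreeAlg k I h} (hxy : Rel A d ρ x y) :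
    toUPh A d ρ x = toUPh A d ρ y :=
  congrArg Completion.ofAlgHom (RingQuot.mkAlgHom_rel k⟦X⟧ hxy)

/-- `T ↦ T` as a linear map. -/
def genTLin : h →ₗ[k⟦X⟧] UPh A d ρ :=
  (toUPh A d ρ).toLinearMap ∘ₗ Completion.of ∘ₗ TensorAlgebra.ι k⟦X⟧ ∘ₗ
    LinearMap.inl k⟦X⟧ h ((I →₀ k⟦X⟧) × (I →₀ k⟦X⟧))

@[simp]
theorem genTLin_apply (T : h) : genTLin A d ρ T = genT A d ρ T := rfl

theorem relSystem_gen : RelSystem A d ρ (genTLin A d ρ) (genE A d ρ) (genF A d ρ) where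
  TE T j := by simpa [HasWeight, genT, genE] using toUPh_eq_of_rel A d ρ (.TE T j)
  TF T j := by simpa [HasWeight, genT, genF] using toUPh_eq_of_rel A d ρ (.TF T j)
  TT T T' := by
    simpa [Commute, SemiconjBy, genT] using toUPh_eq_of_rel A d ρ (.TT T T')
  EF_same i := by
    simpa [map_hExpQuot, genT, genE, genF] using toUPh_eq_of_rel A d ρ (.EF_same i)
  EF_ne {i j} hij := by simpa [genE, genF] using toUPh_eq_of_rel A d ρ (.EF_ne i j hij)
  serreE {i j} hij := by
    have := toUPh_eq_of_rel A d ρ (.serreE i j hij)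
    rwa [sum_serreCoeff_eq_qSerre, map_qSerre, map_zero] at this
  serreF {i j} hij := by
    have := toUPh_eq_of_rel A d ρ (.serreF i j hij)
    rwa [sum_serreCoeff_eq_qSerreRev, map_qSerreRev, map_zero] at this

/-- The set of generators. -/
def generators : Set (UPh A d ρ) :=
  Set.range (genTLin A d ρ) ∪ Set.range (genE A d ρ) ∪ Set.range (genF A d ρ)

variable {A d ρ} in
theorem genT_mem_adjoin (T : h) : genT A d ρ T ∈ Algebra.adjoin k⟦X⟧ (generators A d ρ) :=
  Algebra.subset_adjoin (Or.inl (Or.inl ⟨T, rfl⟩))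

variable {A d ρ} in
theorem genE_mem_adjoin (i : I) : genE A d ρ i ∈ Algebra.adjoin k⟦X⟧ (generators A d ρ) :=
  Algebra.subset_adjoin (Or.inl (Or.inr ⟨i, rfl⟩))

variable {A d ρ} in
theorem genF_mem_adjoin (i : I) : genF A d ρ i ∈ Algebra.adjoin k⟦X⟧ (generators A d ρ) :=
  Algebra.subset_adjoin (Or.inr ⟨i, rfl⟩)

/-- The tensor algebra is dense in the free complete algebra, whose image in `UPh` is dense. By
transitivity it suffices that the image of the tensor algebra lies in the subalgebra generated by
`T`, `Eᵢ`, `Fᵢ`. -/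
theorem isHDense_adjoin :
    IsHDense (Subalgebra.toSubmodule (Algebra.adjoin k⟦X⟧ (generators A d ρ))) := by
  have h1 : IsHDense (LinearMap.range (toUPh A d ρ).toLinearMap) := by
    have h2 := (isHDense_range_of_surjective (f := (RingQuot.mkAlgHom k⟦X⟧ (Rel A d ρ)).toLinearMap)
      (RingQuot.mkAlgHom_surjective _ _)).map (Completion.of (k := k))
      Completion.isHDense_range_of
    rwa [← LinearMap.range_comp] at h2
  have h3 := (Completion.isHDense_range_of (k := k)
    (A := TensorAlgebra k⟦X⟧ (Generators k I h))).map (toUPh A d ρ).toLinearMap h1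
  refine fun n x => ?_
  obtain ⟨_, ⟨_, ⟨a, rfl⟩, rfl⟩, hx⟩ := h3 n x
  refine ⟨_, ?_, hx⟩
  change toUPh A d ρ (Completion.of a) ∈ Algebra.adjoin k⟦X⟧ (generators A d ρ)
  set φ : TensorAlgebra k⟦X⟧ (Generators k I h) →ₐ[k⟦X⟧] UPh A d ρ :=
    (toUPh A d ρ).comp Completion.ofAlgHom with hφ
  clear hx
  suffices h : ∀ v, φ (TensorAlgebra.ι k⟦X⟧ v) ∈
      Algebra.adjoin k⟦X⟧ (generators A d ρ) by
    change φ a ∈ _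
    induction a using TensorAlgebra.induction with
    | algebraMap r => rw [AlgHom.commutes]; exact Subalgebra.algebraMap_mem _ r
    | ι v => exact h v
    | mul a b ha hb => rw [map_mul]; exact mul_mem ha hb
    | add a b ha hb => rw [map_add]; exact add_mem ha hb
  rintro ⟨T, x, y⟩
  have hE : ∀ x : I →₀ k⟦X⟧, φ (TensorAlgebra.ι k⟦X⟧ (0, x, 0)) ∈
      Algebra.adjoin k⟦X⟧ (generators A d ρ) := by
    intro x
    let L : (I →₀ k⟦X⟧) →ₗ[k⟦X⟧] UPh A d ρ := φ.toLinearMap ∘ₗ TensorAlgebra.ι k⟦X⟧ ∘ₗ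
      LinearMap.inr k⟦X⟧ h _ ∘ₗ LinearMap.inl k⟦X⟧ (I →₀ k⟦X⟧) (I →₀ k⟦X⟧)
    change L x ∈ _
    induction x using Finsupp.induction_linear with
    | zero => rw [map_zero]; exact zero_mem _
    | add x y hx hy => rw [map_add]; exact add_mem hx hy
    | single i c =>
      rw [← mul_one c, ← smul_eq_mul, ← Finsupp.smul_single, map_smul]
      exact Subalgebra.smul_mem _ (genE_mem_adjoin i) c
  have hF : ∀ x : I →₀ k⟦X⟧, φ (TensorAlgebra.ι k⟦X⟧ (0, 0, x)) ∈
      Algebra.adjoin k⟦X⟧ (generators A d ρ) := by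
    intro x
    let L : (I →₀ k⟦X⟧) →ₗ[k⟦X⟧] UPh A d ρ := φ.toLinearMap ∘ₗ TensorAlgebra.ι k⟦X⟧ ∘ₗ
      LinearMap.inr k⟦X⟧ h _ ∘ₗ LinearMap.inr k⟦X⟧ (I →₀ k⟦X⟧) (I →₀ k⟦X⟧)
    change L x ∈ _
    induction x using Finsupp.induction_linear with
    | zero => rw [map_zero]; exact zero_mem _
    | add x y hx hy => rw [map_add]; exact add_mem hx hy
    | single i c =>
      rw [← mul_one c, ← smul_eq_mul, ← Finsupp.smul_single, map_smul]
      exact Subalgebra.smul_mem _ (genF_mem_adjoin i) c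
  have hv : ((T, x, y) : Generators k I h) = (T, 0, 0) + (0, x, 0) + (0, 0, y) := by simp
  rw [hv, map_add, map_add, map_add, map_add]
  exact add_mem (add_mem (genT_mem_adjoin T) (hE x)) (hF y)

variable {A d ρ} {B : Type*} [Ring B] [Algebra k⟦X⟧ B] [IsAdicComplete (hIdeal k) B]
  {t : h →ₗ[k⟦X⟧] B} {e f : I → B}

namespace RelSystem

/-- The homomorphism determined by elements satisfying the defining relations. -/
def lift (S : RelSystem A d ρ t e f) : UPh A d ρ →ₐ[k⟦X⟧] B :=
  Completion.extendAlgHom (RingQuot.liftAlgHom k⟦X⟧ ⟨freeLift t e f, by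
    intro x y hxy
    cases hxy with
    | TE T j => simpa [HasWeight] using S.TE T j
    | TF T j => simpa [HasWeight] using S.TF T j
    | TT T T' => simpa using (S.TT T T').eq
    | EF_same i => simpa [map_hExpQuot] using S.EF_same i
    | EF_ne i j hij => simpa using S.EF_ne hij
    | serreE i j hij =>
      rw [sum_serreCoeff_eq_qSerre, map_qSerre, map_zero]
      simpa using S.serreE hij
    | serreF i j hij =>
      rw [sum_serreCoeff_eq_qSerreRev, map_qSerreRev, map_zero]
      simpa using S.serreF hij⟩)

variable (S : RelSystem A d ρ t e f)

theorem lift_toUPh (x : FreeAlg k I h) : S.lift (toUPh A d ρ x) = freeLift t e f x := by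
  rw [lift, toUPh, AlgHom.comp_apply, Completion.ofAlgHom_apply, Completion.extendAlgHom_of,
    RingQuot.liftAlgHom_mkAlgHom_apply]

@[simp]
theorem lift_genT (T : h) : S.lift (genT A d ρ T) = t T := by
  rw [genT, lift_toUPh, freeLift_freeT]

@[simp]
theorem lift_genE (i : I) : S.lift (genE A d ρ i) = e i := by
  rw [genE, lift_toUPh, freeLift_freeE]

@[simp]
theorem lift_genF (i : I) : S.lift (genF A d ρ i) = f i := by
  rw [genF, lift_toUPh, freeLift_freeF]

end RelSystem

end UniversalProperty

/-! ### Hopf structures on topologically generated algebras -/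

section HopfCriterion

variable {k : Type*} [Field k] {H : Type*} [Ring H] [Algebra k⟦X⟧ H]

variable (k H) in
/-- `x ⊗ y ↦ x ⊗ y ⊗ 1` -/
def inclLeft : H ⊗[k⟦X⟧] H →ₐ[k⟦X⟧] H ⊗[k⟦X⟧] (H ⊗[k⟦X⟧] H) :=
  Algebra.TensorProduct.map (AlgHom.id k⟦X⟧ H) Algebra.TensorProduct.includeLeft

variable (k H) in
/-- `x ⊗ y ↦ 1 ⊗ x ⊗ y` -/
def inclRight : H ⊗[k⟦X⟧] H →ₐ[k⟦X⟧] H ⊗[k⟦X⟧] (H ⊗[k⟦X⟧] H) :=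
  Algebra.TensorProduct.includeRight

variable (k H) in
/-- `x ↦ x ⊗ 1 ⊗ 1` -/
def inclFirst : H →ₐ[k⟦X⟧] H ⊗[k⟦X⟧] (H ⊗[k⟦X⟧] H) :=
  Algebra.TensorProduct.includeLeft

variable (k H) in
/-- `x ↦ 1 ⊗ 1 ⊗ x` -/
def inclLast : H →ₐ[k⟦X⟧] H ⊗[k⟦X⟧] (H ⊗[k⟦X⟧] H) :=
  Algebra.TensorProduct.includeRight.comp Algebra.TensorProduct.includeRight

@[simp]
theorem inclLeft_tmul (x y : H) : inclLeft k H (x ⊗ₜ y) = x ⊗ₜ (y ⊗ₜ 1) := rfl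

@[simp]
theorem inclRight_apply (z : H ⊗[k⟦X⟧] H) : inclRight k H z = 1 ⊗ₜ z := rfl

@[simp]
theorem inclFirst_apply (x : H) : inclFirst k H x = x ⊗ₜ 1 := rfl

@[simp]
theorem inclLast_apply (x : H) : inclLast k H x = 1 ⊗ₜ (1 ⊗ₜ x) := rfl

theorem commute_inclLeft_inclLast (a : H ⊗[k⟦X⟧] H) (y : H) :
    Commute (inclLeft k H a) (inclLast k H y) := by
  induction a with
  | zero => simp
  | add a b ha hb => rw [map_add]; exact ha.add_left hb
  | tmul a b => simp [Commute, SemiconjBy]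

theorem commute_inclFirst_inclRight (x : H) (a : H ⊗[k⟦X⟧] H) :
    Commute (inclFirst k H x) (inclRight k H a) := by
  simp [Commute, SemiconjBy]

/-- `Δ ⊗ id` as a homomorphism of algebras. -/
def comulTensorIdHom (Δ : H →ₐ[k⟦X⟧] Completion k (H ⊗[k⟦X⟧] H)) :
    H ⊗[k⟦X⟧] H →ₐ[k⟦X⟧] Completion k (H ⊗[k⟦X⟧] (H ⊗[k⟦X⟧] H)) :=
  Algebra.TensorProduct.lift ((Completion.mapAlgHom (inclLeft k H)).comp Δ)
    (Completion.ofAlgHom.comp (inclLast k H)) (by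
      intro x y
      rw [AlgHom.comp_apply, AlgHom.comp_apply]
      exact Completion.commute_mapAlgHom (fun a => commute_inclLeft_inclLast a y) (Δ x))

theorem comulTensorIdHom_toLinearMap (Δ : H →ₐ[k⟦X⟧] Completion k (H ⊗[k⟦X⟧] H)) :
    (comulTensorIdHom Δ).toLinearMap = comulTensorId Δ.toLinearMap := by
  refine TensorProduct.ext' fun a b => ?_
  have h : (inclLeft k H).toLinearMap =
      LinearMap.lTensor H ((TensorProduct.mk k⟦X⟧ H H).flip 1) :=
    TensorProduct.ext' fun a b => rfl
  simp only [comulTensorIdHom, comulTensorId, AlgHom.toLinearMap_apply,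
    TensorProduct.lift.tmul, ← h]
  rfl

/-- `id ⊗ Δ` as a homomorphism of algebras. -/
def idTensorComulHom (Δ : H →ₐ[k⟦X⟧] Completion k (H ⊗[k⟦X⟧] H)) :
    H ⊗[k⟦X⟧] H →ₐ[k⟦X⟧] Completion k (H ⊗[k⟦X⟧] (H ⊗[k⟦X⟧] H)) :=
  Algebra.TensorProduct.lift (Completion.ofAlgHom.comp (inclFirst k H))
    ((Completion.mapAlgHom (inclRight k H)).comp Δ) (by
      intro x y
      rw [AlgHom.comp_apply, AlgHom.comp_apply]
      exact (Completion.commute_mapAlgHom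
        (fun a => (commute_inclFirst_inclRight x a).symm) (Δ y)).symm)

theorem idTensorComulHom_toLinearMap (Δ : H →ₐ[k⟦X⟧] Completion k (H ⊗[k⟦X⟧] H)) :
    (idTensorComulHom Δ).toLinearMap = idTensorComul Δ.toLinearMap := by
  refine TensorProduct.ext' fun a b => ?_
  simp only [idTensorComulHom, idTensorComul, AlgHom.toLinearMap_apply,
    TensorProduct.lift.tmul]
  rfl

variable [IsAdicComplete (hIdeal k) H]

omit [IsAdicComplete (hIdeal k) H] in
theorem IsHDense.algHom_ext {s : Set H}
    (hs : IsHDense (Subalgebra.toSubmodule (Algebra.adjoin k⟦X⟧ s)))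
    {B : Type*} [Ring B] [Algebra k⟦X⟧ B] [IsAdicComplete (hIdeal k) B] {f g : H →ₐ[k⟦X⟧] B}
    (h : ∀ x ∈ s, f x = g x) : f = g := by
  have := hs.linearMap_ext (f := f.toLinearMap) (g := g.toLinearMap)
    fun y hy => AlgHom.adjoin_le_equalizer f g h hy
  exact AlgHom.toLinearMap_injective this

/-- `m (S ⊗ id)`. -/
def antipodeMulLeft (S : H →ₗ[k⟦X⟧] H) : Completion k (H ⊗[k⟦X⟧] H) →ₗ[k⟦X⟧] H :=
  Completion.extend (LinearMap.mul' k⟦X⟧ H ∘ₗ LinearMap.rTensor H S)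

/-- `m (id ⊗ S)`. -/
def antipodeMulRight (S : H →ₗ[k⟦X⟧] H) : Completion k (H ⊗[k⟦X⟧] H) →ₗ[k⟦X⟧] H :=
  Completion.extend (LinearMap.mul' k⟦X⟧ H ∘ₗ LinearMap.lTensor H S)

@[simp]
theorem antipodeMulLeft_of_tmul (S : H →ₗ[k⟦X⟧] H) (a b : H) :
    antipodeMulLeft S (Completion.of (a ⊗ₜ b)) = S a * b := by
  simp [antipodeMulLeft, Completion.extend_of]

@[simp]
theorem antipodeMulRight_of_tmul (S : H →ₗ[k⟦X⟧] H) (a b : H) :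
    antipodeMulRight S (Completion.of (a ⊗ₜ b)) = a * S b := by
  simp [antipodeMulRight, Completion.extend_of]

/-- For `w = a ⊗ b`, the antihomomorphism property gives `m(S ⊗ id)(z w) = S(a) · m(S ⊗ id)(z) · b`,
and the scalar in the middle moves out. This replaces multiplicativity, which `m(S ⊗ id)` lacks. -/
theorem antipodeMulLeft_mul {S : H →ₗ[k⟦X⟧] H} (hS : ∀ x y, S (x * y) = S y * S x)
    {z : Completion k (H ⊗[k⟦X⟧] H)} {c : k⟦X⟧} (hz : antipodeMulLeft S z = algebraMap k⟦X⟧ H c)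
    (w : Completion k (H ⊗[k⟦X⟧] H)) :
    antipodeMulLeft S (z * w) = c • antipodeMulLeft S w := by
  have h1 : ∀ a b, antipodeMulLeft S ∘ₗ LinearMap.mulRight k⟦X⟧ (Completion.of (a ⊗ₜ b)) =
      LinearMap.mulLeft k⟦X⟧ (S a) ∘ₗ LinearMap.mulRight k⟦X⟧ b ∘ₗ antipodeMulLeft S := by
    intro a b
    refine Completion.linearMap_ext fun z => ?_
    induction z with
    | zero => simp only [map_zero]
    | add x y hx hy => simp only [map_add, hx, hy]
    | tmul x y => simp [← Completion.of_mul, hS, mul_assoc]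
  have h2 : antipodeMulLeft S ∘ₗ LinearMap.mulLeft k⟦X⟧ z = c • antipodeMulLeft S := by
    refine Completion.linearMap_ext fun w => ?_
    induction w with
    | zero => simp only [map_zero]
    | add x y hx hy => simp only [map_add, hx, hy]
    | tmul a b =>
      have := LinearMap.congr_fun (h1 a b) z
      simp only [LinearMap.comp_apply, LinearMap.mulRight_apply, LinearMap.mulLeft_apply, hz,
        LinearMap.smul_apply, antipodeMulLeft_of_tmul] at this ⊢
      rw [this, ← Algebra.smul_def, mul_smul_comm]
  exact LinearMap.congr_fun h2 w

theorem antipodeMulRight_mul {S : H →ₗ[k⟦X⟧] H} (hS : ∀ x y, S (x * y) = S y * S x)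
    {z : Completion k (H ⊗[k⟦X⟧] H)} {c : k⟦X⟧} (hz : antipodeMulRight S z = algebraMap k⟦X⟧ H c)
    (w : Completion k (H ⊗[k⟦X⟧] H)) :
    antipodeMulRight S (w * z) = c • antipodeMulRight S w := by
  have h1 : ∀ a b, antipodeMulRight S ∘ₗ LinearMap.mulLeft k⟦X⟧ (Completion.of (a ⊗ₜ b)) =
      LinearMap.mulLeft k⟦X⟧ a ∘ₗ LinearMap.mulRight k⟦X⟧ (S b) ∘ₗ antipodeMulRight S := by
    intro a b
    refine Completion.linearMap_ext fun z => ?_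
    induction z with
    | zero => simp only [map_zero]
    | add x y hx hy => simp only [map_add, hx, hy]
    | tmul x y => simp [← Completion.of_mul, hS, mul_assoc]
  have h2 : antipodeMulRight S ∘ₗ LinearMap.mulRight k⟦X⟧ z = c • antipodeMulRight S := by
    refine Completion.linearMap_ext fun w => ?_
    induction w with
    | zero => simp only [map_zero]
    | add x y hx hy => simp only [map_add, hx, hy]
    | tmul a b =>
      have := LinearMap.congr_fun (h1 a b) z
      simp only [LinearMap.comp_apply, LinearMap.mulRight_apply, LinearMap.mulLeft_apply, hz,
        LinearMap.smul_apply, antipodeMulRight_of_tmul] at this ⊢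
      rw [this, ← Algebra.smul_def, mul_smul_comm]
  exact LinearMap.congr_fun h2 w

/-- The Hopf axioms need only be checked on topological generators. -/
def TopHopfStructure.ofGenerators {s : Set H}
    (hs : IsHDense (Subalgebra.toSubmodule (Algebra.adjoin k⟦X⟧ s)))
    (Δ : H →ₐ[k⟦X⟧] Completion k (H ⊗[k⟦X⟧] H)) (ε : H →ₐ[k⟦X⟧] k⟦X⟧) (S : H →ₐ[k⟦X⟧] Hᵐᵒᵖ)
    (coassoc : ∀ x ∈ s, Completion.extendAlgHom (comulTensorIdHom Δ) (Δ x) =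
      Completion.extendAlgHom (idTensorComulHom Δ) (Δ x))
    (counit_left : ∀ x ∈ s, Completion.extendAlgHom
      ((Algebra.TensorProduct.lid k⟦X⟧ H).toAlgHom.comp
        (Algebra.TensorProduct.map ε (AlgHom.id k⟦X⟧ H))) (Δ x) = x)
    (counit_right : ∀ x ∈ s, Completion.extendAlgHom
      ((Algebra.TensorProduct.rid k⟦X⟧ k⟦X⟧ H).toAlgHom.comp
        (Algebra.TensorProduct.map (AlgHom.id k⟦X⟧ H) ε)) (Δ x) = x)
    (antipode_left : ∀ x ∈ s, antipodeMulLeft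
      ((MulOpposite.opLinearEquiv k⟦X⟧).symm.toLinearMap ∘ₗ S.toLinearMap) (Δ x) =
        algebraMap k⟦X⟧ H (ε x))
    (antipode_right : ∀ x ∈ s, antipodeMulRight
      ((MulOpposite.opLinearEquiv k⟦X⟧).symm.toLinearMap ∘ₗ S.toLinearMap) (Δ x) =
        algebraMap k⟦X⟧ H (ε x)) :
    TopHopfStructure k H where
  comul := Δ
  counit := ε
  antipode := (MulOpposite.opLinearEquiv k⟦X⟧).symm.toLinearMap ∘ₗ S.toLinearMap
  coassoc x := by
    rw [← comulTensorIdHom_toLinearMap, ← idTensorComulHom_toLinearMap]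
    -- Both sides are algebra homomorphisms in `x`, so agreement on generators suffices.
    exact DFunLike.congr_fun (hs.algHom_ext
      (f := (Completion.extendAlgHom (comulTensorIdHom Δ)).comp Δ)
      (g := (Completion.extendAlgHom (idTensorComulHom Δ)).comp Δ) coassoc) x
  counit_left x :=
    DFunLike.congr_fun (hs.algHom_ext (f := (Completion.extendAlgHom
      ((Algebra.TensorProduct.lid k⟦X⟧ H).toAlgHom.comp
        (Algebra.TensorProduct.map ε (AlgHom.id k⟦X⟧ H)))).comp Δ)
      (g := AlgHom.id k⟦X⟧ H) counit_left) x
  counit_right x :=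
    DFunLike.congr_fun (hs.algHom_ext (f := (Completion.extendAlgHom
      ((Algebra.TensorProduct.rid k⟦X⟧ k⟦X⟧ H).toAlgHom.comp
        (Algebra.TensorProduct.map (AlgHom.id k⟦X⟧ H) ε))).comp Δ)
      (g := AlgHom.id k⟦X⟧ H) counit_right) x
  antipode_left x := by
    refine LinearMap.congr_fun (hs.linearMap_ext
      (f := antipodeMulLeft _ ∘ₗ Δ.toLinearMap)
      (g := Algebra.linearMap k⟦X⟧ H ∘ₗ ε.toLinearMap) fun y hy => ?_) x
    -- The two sides are compared only as linear maps, so products are handled through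
    -- `antipodeMulLeft_mul`.
    refine Algebra.adjoin_induction (fun x hx => antipode_left x hx) (fun r => ?_)
      (fun x y _ _ hx hy => ?_) (fun x y _ _ hx hy => ?_) hy
    · simp only [LinearMap.comp_apply, AlgHom.toLinearMap_apply, AlgHom.commutes]
      rw [Algebra.algebraMap_eq_smul_one, map_smul, ← Completion.of_one,
        Algebra.TensorProduct.one_def, antipodeMulLeft_of_tmul]
      simp [Algebra.algebraMap_eq_smul_one]
    · simp only [map_add, hx, hy]
    · simp only [LinearMap.comp_apply, AlgHom.toLinearMap_apply, map_mul] at hx hy ⊢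
      rw [antipodeMulLeft_mul (fun x y => by simp) hx, hy]
      simp [Algebra.smul_def]
  antipode_right x := by
    refine LinearMap.congr_fun (hs.linearMap_ext
      (f := antipodeMulRight _ ∘ₗ Δ.toLinearMap)
      (g := Algebra.linearMap k⟦X⟧ H ∘ₗ ε.toLinearMap) fun y hy => ?_) x
    refine Algebra.adjoin_induction (fun x hx => antipode_right x hx) (fun r => ?_)
      (fun x y _ _ hx hy => ?_) (fun x y _ _ hx hy => ?_) hy
    · simp only [LinearMap.comp_apply, AlgHom.toLinearMap_apply, AlgHom.commutes]
      rw [Algebra.algebraMap_eq_smul_one, map_smul, ← Completion.of_one,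
        Algebra.TensorProduct.one_def, antipodeMulRight_of_tmul]
      simp [Algebra.algebraMap_eq_smul_one]
    · simp only [map_add, hx, hy]
    · simp only [LinearMap.comp_apply, AlgHom.toLinearMap_apply, map_mul] at hx hy ⊢
      rw [antipodeMulRight_mul (fun x y => by simp) hy, hx]
      simp only [Algebra.linearMap_apply]
      rw [Algebra.smul_def, ← map_mul, mul_comm]

end HopfCriterion

/-! ### Primitive and skew primitive elements -/

section SkewPrimitive

variable {k : Type*} [Field k] {H : Type*} [Ring H] [Algebra k⟦X⟧ H]
  {Δ : H →ₐ[k⟦X⟧] Completion k (H ⊗[k⟦X⟧] H)}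

theorem comulTensorIdHom_tmul {a b : H} {z : H ⊗[k⟦X⟧] H} (ha : Δ a = Completion.of z) :
    comulTensorIdHom Δ (a ⊗ₜ b) = Completion.of (inclLeft k H z * inclLast k H b) := by
  rw [comulTensorIdHom, Algebra.TensorProduct.lift_tmul, AlgHom.comp_apply, ha,
    Completion.mapAlgHom_of]
  rfl

theorem idTensorComulHom_tmul {a b : H} {z : H ⊗[k⟦X⟧] H} (hb : Δ b = Completion.of z) :
    idTensorComulHom Δ (a ⊗ₜ b) = Completion.of (inclFirst k H a * inclRight k H z) := by
  rw [idTensorComulHom, Algebra.TensorProduct.lift_tmul, AlgHom.comp_apply, AlgHom.comp_apply, hb,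
    Completion.mapAlgHom_of]
  rfl

variable (Δ) in
/-- Skew primitive elements, relative to two grouplike elements, are coassociative. -/
theorem coassoc_of_skewPrimitive {x g g' : H} (hg : Δ g = Completion.of (g ⊗ₜ g))
    (hg' : Δ g' = Completion.of (g' ⊗ₜ g')) (hx : Δ x = Completion.of (x ⊗ₜ g' + g ⊗ₜ x)) :
    Completion.extendAlgHom (comulTensorIdHom Δ) (Δ x) =
      Completion.extendAlgHom (idTensorComulHom Δ) (Δ x) := by
  rw [hx, Completion.extendAlgHom_of, Completion.extendAlgHom_of, map_add, map_add,
    comulTensorIdHom_tmul hx, comulTensorIdHom_tmul hg, idTensorComulHom_tmul hx,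
    idTensorComulHom_tmul hg', ← map_add, ← map_add]
  -- Both sides are `x ⊗ g' ⊗ g' + g ⊗ x ⊗ g' + g ⊗ g ⊗ x`.
  simp [TensorProduct.tmul_add, add_mul, mul_add, add_assoc]

variable [IsAdicComplete (hIdeal k) H]

theorem extendAlgHom_counit_left {ε : H →ₐ[k⟦X⟧] k⟦X⟧} {x g g' : H} (hg : ε g = 1)
    (hxε : ε x = 0) (hx : Δ x = Completion.of (x ⊗ₜ g' + g ⊗ₜ x)) :
    Completion.extendAlgHom ((Algebra.TensorProduct.lid k⟦X⟧ H).toAlgHom.comp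
        (Algebra.TensorProduct.map ε (AlgHom.id k⟦X⟧ H))) (Δ x) = x := by
  rw [hx, Completion.extendAlgHom_of]
  simp [hg, hxε]

theorem extendAlgHom_counit_right {ε : H →ₐ[k⟦X⟧] k⟦X⟧} {x g g' : H} (hg' : ε g' = 1)
    (hxε : ε x = 0) (hx : Δ x = Completion.of (x ⊗ₜ g' + g ⊗ₜ x)) :
    Completion.extendAlgHom ((Algebra.TensorProduct.rid k⟦X⟧ k⟦X⟧ H).toAlgHom.comp
        (Algebra.TensorProduct.map (AlgHom.id k⟦X⟧ H) ε)) (Δ x) = x := by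
  rw [hx, Completion.extendAlgHom_of]
  simp [hg', hxε]

theorem antipodeMulLeft_comul {S : H →ₗ[k⟦X⟧] H} {x g g' : H}
    (hS : S x * g' + S g * x = 0) (hx : Δ x = Completion.of (x ⊗ₜ g' + g ⊗ₜ x)) :
    antipodeMulLeft S (Δ x) = 0 := by
  rw [hx, map_add, map_add, antipodeMulLeft_of_tmul, antipodeMulLeft_of_tmul, hS]

theorem antipodeMulRight_comul {S : H →ₗ[k⟦X⟧] H} {x g g' : H}
    (hS : x * S g' + g * S x = 0) (hx : Δ x = Completion.of (x ⊗ₜ g' + g ⊗ₜ x)) :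
    antipodeMulRight S (Δ x) = 0 := by
  rw [hx, map_add, map_add, antipodeMulRight_of_tmul, antipodeMulRight_of_tmul, hS]

variable [CharZero k]

/-- Since `x ⊗ 1` and `1 ⊗ x` commute, the exponential of their sum is a product. -/
theorem comul_hExp {x : H} (hx : Δ x = Completion.of (x ⊗ₜ 1 + 1 ⊗ₜ x)) :
    Δ (hExp k x) = Completion.of (hExp k x ⊗ₜ hExp k x) := by
  have h1 := map_hExp (k := k) (Completion.ofAlgHom.comp
    (Algebra.TensorProduct.includeLeft : H →ₐ[k⟦X⟧] H ⊗[k⟦X⟧] H)) x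
  have h2 := map_hExp (k := k) (Completion.ofAlgHom.comp
    (Algebra.TensorProduct.includeRight : H →ₐ[k⟦X⟧] H ⊗[k⟦X⟧] H)) x
  simp only [AlgHom.comp_apply, Completion.ofAlgHom_apply,
    Algebra.TensorProduct.includeLeft_apply, Algebra.TensorProduct.includeRight_apply] at h1 h2
  have hc : Commute (Completion.of (x ⊗ₜ[k⟦X⟧] (1 : H)) : Completion k (H ⊗[k⟦X⟧] H))
      (Completion.of (1 ⊗ₜ x)) := by
    rw [Commute, SemiconjBy, ← Completion.of_mul, ← Completion.of_mul]
    simp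
  rw [map_hExp, hx, map_add, hExp_add hc, ← h1, ← h2, ← Completion.of_mul]
  simp

end SkewPrimitive

/-! ### Assembly of the Hopf structure -/

section RelSystem

variable {k : Type*} [Field k] [CharZero k] {I : Type*} {h : Type*} [AddCommGroup h]
  [Module k⟦X⟧ h] {A : Matrix I I ℤ} {d : I → ℕ} {P : Matrix I I k⟦X⟧} {ρ : Realization P h}
  {H : Type*} [Ring H] [Algebra k⟦X⟧ H] [IsAdicComplete (hIdeal k) H]
  {t : h →ₗ[k⟦X⟧] H} {e f : I → H}

omit [CharZero k] [IsAdicComplete (hIdeal k) H] in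
theorem commute_of_tmul_one (x y : H) :
    Commute ((Completion.ofAlgHom (k := k)).comp
        (Algebra.TensorProduct.includeLeft : H →ₐ[k⟦X⟧] H ⊗[k⟦X⟧] H) x)
      (Completion.ofAlgHom.comp
        (Algebra.TensorProduct.includeRight : H →ₐ[k⟦X⟧] H ⊗[k⟦X⟧] H) y) :=
  Commute.map (by simp [Commute, SemiconjBy]) Completion.ofAlgHom

theorem RelSystem.comul (S : RelSystem A d ρ t e f) (hA : IsGCM A) (hP : IsCartanType A d P) :
    RelSystem A d ρ
      (Completion.of ∘ₗ ((TensorProduct.mk k⟦X⟧ H H).flip 1 + TensorProduct.mk k⟦X⟧ H H 1) ∘ₗ t)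
      (fun l => (Completion.of (e l ⊗ₜ 1 + hExp k (t (ρ.Tp l)) ⊗ₜ e l) :
        Completion k (H ⊗[k⟦X⟧] H)))
      (fun l => Completion.of (f l ⊗ₜ hExp k (-t (ρ.Tm l)) + 1 ⊗ₜ f l)) := by
  convert S.tensor commute_of_tmul_one hA hP using 1
  · ext T
    simp
  · ext l
    simp [← Completion.of_mul]
  · ext l
    simp [← Completion.of_mul]

/-- All generators are skew primitive: the grouplike pair `(g, g')` is `(1, 1)` for `T`, `(e^{ħT⁺},
1)` for `E` and `(1, e^{-ħT⁻})` for `F`. -/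
theorem exists_topHopfStructure
    (hs : IsHDense (Subalgebra.toSubmodule
      (Algebra.adjoin k⟦X⟧ (Set.range t ∪ Set.range e ∪ Set.range f))))
    {a b : I → h} {Δ : H →ₐ[k⟦X⟧] Completion k (H ⊗[k⟦X⟧] H)} {ε : H →ₐ[k⟦X⟧] k⟦X⟧}
    {σ : H →ₐ[k⟦X⟧] Hᵐᵒᵖ}
    (ΔT : ∀ T, Δ (t T) = Completion.of (t T ⊗ₜ 1 + 1 ⊗ₜ t T))
    (ΔE : ∀ l, Δ (e l) = Completion.of (e l ⊗ₜ 1 + hExp k (t (a l)) ⊗ₜ e l))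
    (ΔF : ∀ l, Δ (f l) = Completion.of (f l ⊗ₜ hExp k (-t (b l)) + 1 ⊗ₜ f l))
    (εT : ∀ T, ε (t T) = 0) (εE : ∀ l, ε (e l) = 0) (εF : ∀ l, ε (f l) = 0)
    (σT : ∀ T, σ (t T) = -MulOpposite.op (t T))
    (σE : ∀ l, σ (e l) = MulOpposite.op (-(hExp k (-t (a l)) * e l)))
    (σF : ∀ l, σ (f l) = MulOpposite.op (-(f l * hExp k (t (b l))))) :
    ∃ S : TopHopfStructure k H, S.comul = Δ ∧ S.counit = ε ∧
      ∀ x, S.antipode x = (σ x).unop := by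
  have hK : ∀ T, Δ (hExp k (t T)) = Completion.of (hExp k (t T) ⊗ₜ hExp k (t T)) := fun T =>
    comul_hExp (ΔT T)
  have hone : Δ 1 = Completion.of (1 ⊗ₜ 1) := map_one Δ
  have hεK : ∀ T, ε (hExp k (t T)) = 1 := fun T => by rw [map_hExp, εT, hExp_zero]
  have hσK : ∀ T, σ (hExp k (t T)) = MulOpposite.op (hExp k (-t T)) := fun T => by
    rw [map_hExp, σT, ← MulOpposite.op_neg, ← op_hExp]
  refine ⟨TopHopfStructure.ofGenerators hs Δ ε σ ?_ ?_ ?_ ?_ ?_, rfl, rfl, fun _ => rfl⟩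
  · rintro _ ((⟨T, rfl⟩ | ⟨l, rfl⟩) | ⟨l, rfl⟩)
    · exact coassoc_of_skewPrimitive Δ hone hone (ΔT T)
    · exact coassoc_of_skewPrimitive Δ (hK _) hone (ΔE l)
    -- By linearity of `t`, `e^{-ħt(b)}` is the exponential of `t(-b)`, hence grouplike.
    · exact coassoc_of_skewPrimitive Δ hone (map_neg t _ ▸ hK _) (ΔF l)
  · rintro _ ((⟨T, rfl⟩ | ⟨l, rfl⟩) | ⟨l, rfl⟩)
    · exact extendAlgHom_counit_left (map_one ε) (εT T) (ΔT T)
    · exact extendAlgHom_counit_left (hεK _) (εE l) (ΔE l)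
    · exact extendAlgHom_counit_left (map_one ε) (εF l) (ΔF l)
  · rintro _ ((⟨T, rfl⟩ | ⟨l, rfl⟩) | ⟨l, rfl⟩)
    · exact extendAlgHom_counit_right (map_one ε) (εT T) (ΔT T)
    · exact extendAlgHom_counit_right (map_one ε) (εE l) (ΔE l)
    · exact extendAlgHom_counit_right (map_neg t _ ▸ hεK _) (εF l) (ΔF l)
  · rintro _ ((⟨T, rfl⟩ | ⟨l, rfl⟩) | ⟨l, rfl⟩)
    · rw [εT, map_zero]
      refine antipodeMulLeft_comul ?_ (ΔT T)
      simp [σT]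
    · rw [εE, map_zero]
      refine antipodeMulLeft_comul ?_ (ΔE l)
      simp [σE, hσK]
    · rw [εF, map_zero]
      refine antipodeMulLeft_comul ?_ (ΔF l)
      simp [σF, mul_assoc, hExp_mul_hExp_neg]
  · rintro _ ((⟨T, rfl⟩ | ⟨l, rfl⟩) | ⟨l, rfl⟩)
    · rw [εT, map_zero]
      refine antipodeMulRight_comul ?_ (ΔT T)
      simp [σT]
    · rw [εE, map_zero]
      refine antipodeMulRight_comul ?_ (ΔE l)
      simp [σE, ← mul_assoc, hExp_mul_hExp_neg]
    · rw [εF, map_zero]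
      refine antipodeMulRight_comul ?_ (ΔF l)
      have : σ (hExp k (-t (b l))) = MulOpposite.op (hExp k (t (b l))) := by
        rw [← map_neg, hσK, map_neg, neg_neg]
      simp [σF, this]

end RelSystem

end FoMpQUEA

end

theorem mainTheorem2 {k : Type*} [Field k] [CharZero k] {I : Type*} [Fintype I]
    (A : Matrix I I ℤ) (hA : IsGCM A) (d : I → ℕ) (hd : IsSymmetrizer A d)
    (P : Matrix I I k⟦X⟧) (hP : IsCartanType A d P)
    {h : Type*} [AddCommGroup h] [Module k⟦X⟧ h] [Module.Free k⟦X⟧ h] [Module.Finite k⟦X⟧ h]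
    (ρ : Realization P h) :
    ∃ S : TopHopfStructure k (UPh A d ρ),
      (∀ l : I, S.comul (genE A d ρ l) =
        Completion.of (genE A d ρ l ⊗ₜ[k⟦X⟧] 1 +
          hExp k (genT A d ρ (ρ.Tp l)) ⊗ₜ[k⟦X⟧] genE A d ρ l)) ∧
      (∀ T : h, S.comul (genT A d ρ T) =
        Completion.of (genT A d ρ T ⊗ₜ[k⟦X⟧] 1 + 1 ⊗ₜ[k⟦X⟧] genT A d ρ T)) ∧
      (∀ l : I, S.comul (genF A d ρ l) =
        Completion.of (genF A d ρ l ⊗ₜ[k⟦X⟧] hExp k (-genT A d ρ (ρ.Tm l)) +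
          1 ⊗ₜ[k⟦X⟧] genF A d ρ l)) ∧
      (∀ l : I, S.counit (genE A d ρ l) = 0) ∧
      (∀ T : h, S.counit (genT A d ρ T) = 0) ∧
      (∀ l : I, S.counit (genF A d ρ l) = 0) ∧
      (∀ l : I, S.antipode (genE A d ρ l) =
        -(hExp k (-genT A d ρ (ρ.Tp l)) * genE A d ρ l)) ∧
      (∀ T : h, S.antipode (genT A d ρ T) = -genT A d ρ T) ∧
      (∀ l : I, S.antipode (genF A d ρ l) =
        -(genF A d ρ l * hExp k (genT A d ρ (ρ.Tm l)))) := by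
  -- The generators form a `RelSystem` in `UPh` itself; the systems defining the coproduct and the
  -- antipode are derived from it.
  have hS := relSystem_gen A d ρ
  have hΔ := hS.comul hA hP
  have hσ := hS.antipode hA hP
  have hε : RelSystem A d ρ (0 : h →ₗ[k⟦X⟧] k⟦X⟧) 0 0 := .zero
  obtain ⟨S, h1, h2, h3⟩ := exists_topHopfStructure (Δ := hΔ.lift) (ε := hε.lift) (σ := hσ.lift)
    (isHDense_adjoin A d ρ) hΔ.lift_genT hΔ.lift_genE hΔ.lift_genF hε.lift_genT hε.lift_genE
    hε.lift_genF hσ.lift_genT hσ.lift_genE hσ.lift_genF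
  refine ⟨S, ?_, ?_, ?_, ?_, ?_, ?_, ?_, ?_, ?_⟩
  · rw [h1]; exact hΔ.lift_genE
  · rw [h1]; exact hΔ.lift_genT
  · rw [h1]; exact hΔ.lift_genF
  · rw [h2]; exact hε.lift_genE
  · rw [h2]; exact hε.lift_genT
  · rw [h2]; exact hε.lift_genF
  · exact fun l => (h3 _).trans (congrArg MulOpposite.unop (hσ.lift_genE l))
  · exact fun T => (h3 _).trans (congrArg MulOpposite.unop (hσ.lift_genT T))
  · exact fun l => (h3 _).trans (congrArg MulOpposite.unop (hσ.lift_genF l))
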